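/- Let $K_n\times K_2$ denote the $n$-prism graph: two disjoint copies of the complete graph $K_n$ together with the $n$ \emph{matching edges} joining corresponding vertices. Embeddings are cellular embeddings in closed orientable surfaces, described by rotation systems; the genus $g$ of an embedding with vertex, edge and face sets $V,E,F$ is given by $|V|-|E|+|F|=2-2g$, and the genus of a connected graph is the smallest genus of such an embedding of it. An embedding of $K_n\times K_2$ is called \emph{snug} if every face incident with at least one matching edge is a quadrilateral (its boundary walk has length $4$) and every other face is a triangle (its boundary walk has length $3$). Let $s\ge 1$ be an integer and $n=12s+5$. Then there exists a snug embedding of $K_n\times K_2$, and it has genus $\frac{(n-2)(n-3)}{6}$. Consequently the genus of the graph $K_n\times K_2$ is exactly $\frac{(n-2)(n-3)}{6}$ (which is an integer). -/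

import Mathlib

namespace SimpleGraph

/-- A rotation system of a simple graph, i.e. a cellular embedding of a connected graph in an
oriented closed surface: a permutation of the darts (arcs) which, at every vertex `v`,
restricts to one cyclic permutation of all the darts leaving `v`. -/
structure RotationSystem {V : Type*} (G : SimpleGraph V) where
  /-- The successor of a dart in the rotation at its initial vertex. -/
  rot : Equiv.Perm G.Dart
  fst_rot : ∀ d : G.Dart, (rot d).fst = d.fst
  sameCycle : ∀ d e : G.Dart, d.fst = e.fst → rot.SameCycle d e

namespace RotationSystem

variable {V : Type*} {G : SimpleGraph V}

/-- Face tracing: after the dart from `u` to `v`, the boundary walk of a face continues with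
the dart that follows the reversed dart, from `v` to `u`, in the rotation at `v`. -/
def faceNext (R : RotationSystem G) : Equiv.Perm G.Dart :=
  (Function.Involutive.toPerm Dart.symm Dart.symm_involutive).trans R.rot

/-- The faces of the embedding: the cycles of the face-tracing permutation. Every dart (every
side of an edge) lies on exactly one face. -/
def Face (R : RotationSystem G) : Type _ :=
  Quotient (Equiv.Perm.SameCycle.setoid R.faceNext)

/-- The face whose boundary walk traverses the dart `d`. -/
def faceOf (R : RotationSystem G) (d : G.Dart) : R.Face :=
  Quotient.mk (Equiv.Perm.SameCycle.setoid R.faceNext) d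

/-- The darts traversed by the boundary walk of a face. -/
def boundary (R : RotationSystem G) (f : R.Face) : Set G.Dart :=
  {d | R.faceOf d = f}

/-- The number of sides of a face: the length of its boundary walk (an edge that has the face
on both of its sides counts twice). -/
noncomputable def numSides (R : RotationSystem G) (f : R.Face) : ℕ :=
  (R.boundary f).ncard

/-- The embedding is in the orientable surface of genus `g`, by the Euler polyhedral equation
`|V| - |E| + |F| = 2 - 2 g`. The graph is finite and connected (so that the surface is) and has
at least one edge. -/
def HasGenus [Finite V] (R : RotationSystem G) (g : ℕ) : Prop :=
  G.Connected ∧ G.edgeSet.Nonempty ∧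
    (Nat.card V : ℤ) - (Nat.card G.edgeSet : ℤ) + (Nat.card R.Face : ℤ) = 2 - 2 * (g : ℤ)

end RotationSystem

/-- `g` is the (minimum) genus of the finite connected graph `G` (with at least one edge): the
smallest genus of an orientable surface in which `G` is cellularly embedded. -/
def IsMinGenus {V : Type*} [Finite V] (G : SimpleGraph V) (g : ℕ) : Prop :=
  IsLeast {h : ℕ | ∃ R : RotationSystem G, R.HasGenus h} g

/-- The `n`-prism graph `K_n × K_2`, the Cartesian product of complete graphs: distinct
vertices are adjacent iff they agree in one of their two coordinates. -/
def prismGraph (n : ℕ) : SimpleGraph (Fin n × Fin 2) :=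
  completeGraph (Fin n) □ completeGraph (Fin 2)

/-- A dart of the prism runs along a matching edge, i.e. along an edge joining `(a, 0)` and
`(a, 1)`. -/
def IsMatchingDart {n : ℕ} (d : (prismGraph n).Dart) : Prop :=
  d.fst.1 = d.snd.1

/-- An embedding of the prism is snug if each face that is incident with at least one matching
edge is a quadrilateral and all other faces are triangles. -/
def RotationSystem.IsSnug {n : ℕ} (R : RotationSystem (prismGraph n)) : Prop :=
  ∀ f : R.Face,
    ((∃ d ∈ R.boundary f, IsMatchingDart d) → R.numSides f = 4) ∧
    ((¬ ∃ d ∈ R.boundary f, IsMatchingDart d) → R.numSides f = 3)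

end SimpleGraph

/-! Lower bound. Give matching darts weight 1 and all other darts weight 2. A face without matching
darts has at least three sides, hence weight at least 6. A face with a matching dart must cross back
to the first copy, so it has a second matching dart; each of the two is followed by a non-matching
dart, and the weight is again at least 6. The total weight is `4 n² - 2 n`, so the number of faces
is at most `(4 n² - 2 n) / 6`, and Euler's equation gives `g ≥ (n - 2)(n - 3) / 6`. In a snug
embedding every face has weight exactly 6, so equality holds.

Existence. Suppose oriented triples on `n + 1` points cover every ordered pair of distinct points
exactly once, and the link of every point except one, `p`, is a single cycle. Take the triples for
one copy of `K_n` and their mirror images for the other, and let the matching edge at `v` occupy the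
place of the edge from `v` to `p` in both rotations. Triples avoiding `p` give triangles; a triple
through `p` fuses with its mirror image into a quadrilateral with two matching edges. The link of
`p` plays no part. It could not be a cycle as well: a triangular embedding of `K_{12s+6}` would have
genus `(12s+3)(12s+2)/12`, which is not an integer.

The triple systems. For `s ≤ 6` they are explicit tables checked by computation. For `s ≥ 7` they
come from an index one current graph over `ZMod (12 s + 2)` with four vortices, which makes `12 s +
6` points. Every nonzero current occurs once and Kirchhoff's law holds at the cubic vertices, so
translation produces triples covering all pairs except those of two vortices. A single-orbit
rotation makes the links of the group elements cycles, and a vortex whose current is a generator has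
a cyclic link. The currents 1, `1 - 6 s` and -9 are generators; 6 is not, and its vortex serves as
`p`. Finally 22 triples are exchanged for 26, which cover in addition the 12 ordered pairs of
vortices (`66 + 12 = 78`), while all links except that of `p` stay connected.

The lemmas that carry this are `RotationSystem.six_le_faceWeight`, `prismRotation_isSnug`,
`Exchange.linkConnected_pt`, `GenericPrism.currentGraph_connected` and
`GenericPrism.existsTripleSystem`. -/

/-- A ternary structure on `W` in which `T x y` is the third point of the oriented triple
through `x` and `y`. -/
structure IsTripleSystem {W : Type*} (T : W → W → W) : Prop where
  ne_left : ∀ x y, x ≠ y → T x y ≠ x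
  ne_right : ∀ x y, x ≠ y → T x y ≠ y
  rotate : ∀ x y, x ≠ y → T y (T x y) = x

namespace IsTripleSystem

variable {W : Type*} {T : W → W → W}

theorem rotate' (h : IsTripleSystem T) {x y : W} (hxy : x ≠ y) : T (T x y) x = y := by
  have h1 := h.rotate y (T x y) (h.ne_right x y hxy).symm
  rwa [h.rotate x y hxy] at h1

end IsTripleSystem

/-- The link of `v`, i.e. the map `a ↦ T a v` on the points other than `v`, has one orbit. -/
def LinkConnected {W : Type*} (T : W → W → W) (v : W) : Prop :=
  ∀ r : Setoid W, (∀ a, a ≠ v → r a (T a v)) → ∀ x y, x ≠ v → y ≠ v → r x y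

/-! ### Counting darts, edges and dart weights of the prism. -/

namespace SimpleGraph

theorem prismGraph_adj {n : ℕ} {x y : Fin n × Fin 2} :
    (prismGraph n).Adj x y ↔ x.1 ≠ y.1 ∧ x.2 = y.2 ∨ x.2 ≠ y.2 ∧ x.1 = y.1 := by
  simp [prismGraph, boxProd_adj]

instance (n : ℕ) : DecidableRel (prismGraph n).Adj := fun _ _ =>
  decidable_of_iff' _ prismGraph_adj

theorem prismGraph_connected {n : ℕ} (hn : 0 < n) : (prismGraph n).Connected := by
  have : Nonempty (Fin n) := ⟨⟨0, hn⟩⟩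
  exact Connected.boxProd connected_top connected_top

theorem prismGraph_degree {n : ℕ} (hn : 0 < n) (x : Fin n × Fin 2) :
    (prismGraph n).degree x = n := by
  have h : (prismGraph n).neighborFinset x =
      (Finset.univ.erase x.1).image (fun w => (w, x.2)) ∪ {(x.1, x.2 + 1)} := by
    ext y
    obtain ⟨a, i⟩ := x
    obtain ⟨b, j⟩ := y
    simp only [mem_neighborFinset, prismGraph_adj, Finset.mem_union, Finset.mem_image,
      Finset.mem_erase, Finset.mem_univ, Finset.mem_singleton, Prod.mk.injEq]
    have h : i ≠ j ↔ j = i + 1 := by revert i j; decide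
    constructor
    · rintro (⟨h1, h2⟩ | ⟨h1, h2⟩)
      · exact Or.inl ⟨b, ⟨Ne.symm h1, trivial⟩, rfl, h2⟩
      · exact Or.inr ⟨h2.symm, h.1 h1⟩
    · rintro (⟨c, ⟨h1, -⟩, rfl, rfl⟩ | ⟨rfl, h2⟩)
      · exact Or.inl ⟨Ne.symm h1, rfl⟩
      · exact Or.inr ⟨h.2 h2, rfl⟩
  have hd : Disjoint ((Finset.univ.erase x.1).image (fun w => (w, x.2)))
      {((x.1, x.2 + 1) : Fin n × Fin 2)} := by
    simp
  rw [degree, h, Finset.card_union_of_disjoint hd, Finset.card_image_of_injective]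
  · simp; omega
  · intro a b hab
    simpa using hab

theorem card_prismGraph_dart {n : ℕ} (hn : 0 < n) :
    Fintype.card (prismGraph n).Dart = 2 * n * n := by
  rw [dart_card_eq_sum_degrees]
  simp only [prismGraph_degree hn, Finset.sum_const, Finset.card_univ, Fintype.card_prod,
    Fintype.card_fin, smul_eq_mul]
  ring

theorem card_prismGraph_edgeSet {n : ℕ} (hn : 0 < n) :
    Nat.card (prismGraph n).edgeSet = n * n := by
  have h := dart_card_eq_twice_card_edges (G := prismGraph n)
  rw [card_prismGraph_dart hn] at h
  rw [Nat.card_eq_fintype_card, ← edgeFinset_card]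
  linarith

instance {n : ℕ} : DecidablePred (IsMatchingDart (n := n)) := fun d =>
  inferInstanceAs (Decidable (d.fst.1 = d.snd.1))

theorem isMatchingDart_ext {n : ℕ} {d e : (prismGraph n).Dart} (hd : IsMatchingDart d)
    (he : IsMatchingDart e) (h : d.fst = e.fst) : d = e := by
  have h1 := prismGraph_adj.1 d.adj
  have h2 := prismGraph_adj.1 e.adj
  unfold IsMatchingDart at hd he
  have h3 : ∀ i j k : Fin 2, i ≠ j → i ≠ k → j = k := by decide
  have h4 : d.snd.2 = e.snd.2 := by
    apply h3 d.fst.2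
    · tauto
    · rw [h]; tauto
  ext1
  refine Prod.ext h (Prod.ext ?_ h4)
  rw [← hd, ← he, h]

theorem isMatchingDart_symm {n : ℕ} {d : (prismGraph n).Dart} (hd : IsMatchingDart d) :
    IsMatchingDart d.symm := Eq.symm hd

theorem card_isMatchingDart (n : ℕ) :
    (Finset.univ.filter (IsMatchingDart (n := n))).card = 2 * n := by
  have h : (Finset.univ.filter (IsMatchingDart (n := n))).card =
      (Finset.univ : Finset (Fin n × Fin 2)).card := by
    apply Finset.card_bij (fun d _ => d.fst)
    · simp
    · intro d hd e he hde
      exact isMatchingDart_ext (by simpa using hd) (by simpa using he) hde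
    · intro x _
      refine ⟨⟨(x, (x.1, x.2 + 1)), prismGraph_adj.2 (Or.inr ⟨?_, rfl⟩)⟩, ?_, rfl⟩
      · simp
      · simp [IsMatchingDart]
  rw [h]
  simp [mul_comm]

/-- The weight of a dart: `1` for matching darts and `2` for the others. -/
def dartWeight {n : ℕ} (d : (prismGraph n).Dart) : ℕ := if IsMatchingDart d then 1 else 2

theorem sum_dartWeight {n : ℕ} (hn : 0 < n) :
    ∑ d : (prismGraph n).Dart, dartWeight d + 2 * n = 4 * n * n := by
  have h : ∑ d : (prismGraph n).Dart, dartWeight d +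
      (Finset.univ.filter (IsMatchingDart (n := n))).card = ∑ d : (prismGraph n).Dart, 2 := by
    rw [Finset.card_filter, ← Finset.sum_add_distrib]
    refine Finset.sum_congr rfl fun d _ => ?_
    unfold dartWeight
    split_ifs <;> rfl
  rw [card_isMatchingDart] at h
  rw [h]
  simp only [Finset.sum_const, Finset.card_univ, card_prismGraph_dart hn, smul_eq_mul]
  ring

/-! ### Face lengths, face weights and the genus bound. -/

namespace RotationSystem

section General

variable {V : Type*} {G : SimpleGraph V} (R : RotationSystem G)

theorem faceNext_apply (d : G.Dart) : R.faceNext d = R.rot d.symm := rfl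

theorem fst_faceNext (d : G.Dart) : (R.faceNext d).fst = d.snd := R.fst_rot _

theorem faceOf_eq_iff {d e : G.Dart} : R.faceOf d = R.faceOf e ↔ R.faceNext.SameCycle d e :=
  Quotient.eq (r := Equiv.Perm.SameCycle.setoid R.faceNext)

theorem faceOf_faceNext (d : G.Dart) : R.faceOf (R.faceNext d) = R.faceOf d :=
  R.faceOf_eq_iff.2 (Equiv.Perm.sameCycle_apply_left.2 (Equiv.Perm.SameCycle.refl _ _))

theorem faceNext_ne (d : G.Dart) : R.faceNext d ≠ d := fun h =>
  d.adj.ne (by rw [← R.fst_faceNext d, h])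

/-- A vertex with at least two darts has no dart fixed by the rotation. -/
theorem rot_ne {d e : G.Dart} (hde : d ≠ e) (h : d.fst = e.fst) : R.rot d ≠ d := fun hd => by
  obtain ⟨i, hi⟩ := R.sameCycle d e h
  exact hde (by rw [← hi, Equiv.Perm.zpow_apply_eq_self_of_apply_eq_self hd])

/-- A closed face walk of length two runs back along the same edge, so the rotation fixes a dart.
This excludes digons and makes the darts of short closed walks distinct. -/
theorem faceNext_faceNext_ne (hrot : ∀ d, R.rot d ≠ d) (d : G.Dart) :
    R.faceNext (R.faceNext d) ≠ d := fun h => by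
  apply hrot d.symm
  have h1 : (R.faceNext d).fst = d.snd := R.fst_faceNext d
  have h2 : (R.faceNext d).snd = d.fst := by rw [← R.fst_faceNext, h]
  rw [← R.faceNext_apply]
  ext1
  exact Prod.ext h1 h2

theorem boundary_of_closed [Finite V] {d : G.Dart} {s : Set G.Dart} (hd : d ∈ s)
    (hs : ∀ e ∈ s, R.faceNext e ∈ s) (hs' : ∀ e ∈ s, R.faceOf e = R.faceOf d) :
    R.boundary (R.faceOf d) = s := by
  classical
  have := Fintype.ofFinite V
  apply Set.Subset.antisymm
  · intro e he
    obtain ⟨i, rfl⟩ := (R.faceOf_eq_iff.1 (Eq.symm he) : R.faceNext.SameCycle d e).exists_nat_pow_eq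
    clear he
    induction i with
    | zero => exact hd
    | succ k ih => rw [pow_succ', Equiv.Perm.mul_apply]; exact hs _ ih
  · exact hs'

theorem numSides_eq_three [Finite V] (hrot : ∀ d, R.rot d ≠ d) {d : G.Dart}
    (h : R.faceNext (R.faceNext (R.faceNext d)) = d) : R.numSides (R.faceOf d) = 3 := by
  classical
  rw [numSides, R.boundary_of_closed (s := {d, R.faceNext d, R.faceNext (R.faceNext d)})]
  · rw [Set.ncard_eq_three]
    exact ⟨_, _, _, (R.faceNext_ne d).symm, (R.faceNext_faceNext_ne hrot d).symm,
      (R.faceNext_ne _).symm, rfl⟩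
  · simp
  · rintro e (rfl | rfl | rfl) <;> simp [h]
  · rintro e (rfl | rfl | rfl) <;> simp [faceOf_faceNext]

theorem numSides_eq_four [Finite V] (hrot : ∀ d, R.rot d ≠ d) {d : G.Dart}
    (h : R.faceNext (R.faceNext (R.faceNext (R.faceNext d))) = d) :
    R.numSides (R.faceOf d) = 4 := by
  classical
  rw [numSides, R.boundary_of_closed
    (s := {d, R.faceNext d, R.faceNext (R.faceNext d), R.faceNext (R.faceNext (R.faceNext d))})]
  · have h1 := R.faceNext_ne (R.faceNext (R.faceNext (R.faceNext d)))
    rw [h] at h1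
    have h2 := fun d => (R.faceNext_ne d).symm
    have h3 := fun d => (R.faceNext_faceNext_ne hrot d).symm
    rw [Set.ncard_insert_of_notMem, Set.ncard_eq_three.2 ⟨_, _, _, h2 _, h3 _, h2 _, rfl⟩]
    · simp [h1, h2 d, h3 d]
  · simp
  · rintro e (rfl | rfl | rfl | rfl) <;> simp [h]
  · rintro e (rfl | rfl | rfl | rfl) <;> simp [faceOf_faceNext]

end General

section Prism

variable {n : ℕ} (R : RotationSystem (prismGraph n))

theorem prism_rot_ne (hn : 2 ≤ n) (d : (prismGraph n).Dart) : R.rot d ≠ d := by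
  have h := prismGraph_degree (by omega) d.fst
  have h2 : 1 < ((prismGraph n).neighborFinset d.fst).card := by
    rw [card_neighborFinset_eq_degree]; omega
  obtain ⟨y, hy, hne⟩ := Finset.exists_mem_ne h2 d.snd
  rw [mem_neighborFinset] at hy
  refine R.rot_ne (e := ⟨(d.fst, y), hy⟩) ?_ rfl
  intro h
  apply hne
  rw [h]

theorem not_isMatchingDart_faceNext (hn : 2 ≤ n) {d : (prismGraph n).Dart}
    (hd : IsMatchingDart d) : ¬ IsMatchingDart (R.faceNext d) := fun h =>
  R.prism_rot_ne hn d.symm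
    (isMatchingDart_ext h (isMatchingDart_symm hd) (R.fst_faceNext d))

/-- Only matching darts change the copy, and a closed walk that leaves a copy has to come back. -/
theorem exists_other_matching {d : (prismGraph n).Dart} (hd : IsMatchingDart d) :
    ∃ e, e ≠ d ∧ IsMatchingDart e ∧ R.faceOf e = R.faceOf d := by
  by_contra! hcon
  -- Without a second matching dart the walk never leaves the copy that `d` leads to.
  have key : ∀ j : ℕ, R.faceOf ((R.faceNext ^ (j + 1)) d) = R.faceOf d ∧
      ((R.faceNext ^ (j + 1)) d).fst.2 = d.snd.2 := by
    intro j
    induction j with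
    | zero => simp [faceOf_faceNext, fst_faceNext]
    | succ j ih =>
      obtain ⟨h1, h2⟩ := ih
      rw [pow_succ', Equiv.Perm.mul_apply]
      set e := (R.faceNext ^ (j + 1)) d
      refine ⟨by rw [faceOf_faceNext, h1], ?_⟩
      have hne : e ≠ d := by
        rintro h
        rw [h] at h2
        have := prismGraph_adj.1 d.adj
        unfold IsMatchingDart at hd
        tauto
      have hm : ¬ IsMatchingDart e := fun hm => hcon e hne hm h1
      rw [fst_faceNext, ← h2]
      have := prismGraph_adj.1 e.adj
      unfold IsMatchingDart at hm
      tauto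
  -- After `orderOf R.faceNext` steps the walk is back at `d`, which starts in the other copy.
  have h := (key (orderOf R.faceNext - 1)).2
  rw [Nat.sub_add_cancel (orderOf_pos _), pow_orderOf_eq_one] at h
  have := prismGraph_adj.1 d.adj
  unfold IsMatchingDart at hd
  simp at h
  tauto

open Classical in
/-- The darts on the boundary of a face, as a finset. -/
noncomputable def boundaryFinset (f : R.Face) : Finset (prismGraph n).Dart :=
  Finset.univ.filter fun d => R.faceOf d = f

theorem card_boundaryFinset (f : R.Face) : (R.boundaryFinset f).card = R.numSides f := by
  rw [numSides, ← Set.ncard_coe_finset]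
  congr 1
  ext d
  simp [boundaryFinset, boundary]

theorem mem_boundaryFinset {f : R.Face} {d : (prismGraph n).Dart} :
    d ∈ R.boundaryFinset f ↔ R.faceOf d = f := by simp [boundaryFinset]

theorem sum_boundaryFinset_add (f : R.Face) :
    ∑ d ∈ R.boundaryFinset f, dartWeight d + ((R.boundaryFinset f).filter IsMatchingDart).card =
      2 * R.numSides f := by
  rw [Finset.card_filter, ← Finset.sum_add_distrib, ← card_boundaryFinset, mul_comm,
    ← smul_eq_mul, ← Finset.sum_const]
  refine Finset.sum_congr rfl fun d _ => ?_
  unfold dartWeight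
  split_ifs <;> rfl

theorem exists_faceOf (f : R.Face) : ∃ d, R.faceOf d = f := Quotient.exists_rep f

/-- With a matching dart on the face there are two, whose successors are two further, non-matching
darts: `1 + 1 + 2 + 2`. Otherwise there are three distinct darts of weight 2. -/
theorem six_le_faceWeight (hn : 2 ≤ n) (f : R.Face) :
    6 ≤ ∑ d ∈ R.boundaryFinset f, dartWeight d := by
  by_cases hm : ∃ d, IsMatchingDart d ∧ R.faceOf d = f
  · obtain ⟨d, hd, rfl⟩ := hm
    obtain ⟨e, hne, he, hed⟩ := R.exists_other_matching hd
    have hd' := R.not_isMatchingDart_faceNext hn hd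
    have he' := R.not_isMatchingDart_faceNext hn he
    have hsub : ({d, e, R.faceNext d, R.faceNext e} : Finset _) ⊆ R.boundaryFinset (R.faceOf d) := by
      intro x
      simp only [Finset.mem_insert, Finset.mem_singleton, mem_boundaryFinset]
      rintro (rfl | rfl | rfl | rfl) <;> simp [faceOf_faceNext, hed]
    refine le_trans ?_ (Finset.sum_le_sum_of_subset hsub)
    have h1 : d ≠ R.faceNext d := fun h => hd' (h ▸ hd)
    have h2 : d ≠ R.faceNext e := fun h => he' (h ▸ hd)
    have h3 : e ≠ R.faceNext d := fun h => hd' (h ▸ he)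
    have h4 : e ≠ R.faceNext e := fun h => he' (h ▸ he)
    have h5 : R.faceNext d ≠ R.faceNext e := fun h => hne (R.faceNext.injective h).symm
    rw [Finset.sum_insert (by simp [hne.symm, h1, h2]), Finset.sum_insert (by simp [h3, h4]),
      Finset.sum_insert (by simp [h5]), Finset.sum_singleton]
    simp [dartWeight, hd, he, hd', he']
  · obtain ⟨d, rfl⟩ := R.exists_faceOf f
    push Not at hm
    have hsub : ({d, R.faceNext d, R.faceNext (R.faceNext d)} : Finset _) ⊆
        R.boundaryFinset (R.faceOf d) := by
      intro x
      simp only [Finset.mem_insert, Finset.mem_singleton, mem_boundaryFinset]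
      rintro (rfl | rfl | rfl) <;> simp [faceOf_faceNext]
    refine le_trans ?_ (Finset.sum_le_sum_of_subset hsub)
    have h1 := R.faceNext_ne d
    have h2 := R.faceNext_ne (R.faceNext d)
    have h3 := R.faceNext_faceNext_ne (R.prism_rot_ne hn) d
    have hw : ∀ x, R.faceOf x = R.faceOf d → dartWeight x = 2 := fun x hx =>
      if_neg fun h => hm x h hx
    rw [Finset.sum_insert (by simp [h1.symm, h3.symm]), Finset.sum_insert (by simp [h2.symm]),
      Finset.sum_singleton, hw _ rfl, hw _ (by simp [faceOf_faceNext]),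
      hw _ (by simp [faceOf_faceNext])]
    norm_num

theorem IsSnug.faceWeight_eq (hn : 2 ≤ n) (hR : R.IsSnug) (f : R.Face) :
    ∑ d ∈ R.boundaryFinset f, dartWeight d = 6 := by
  apply le_antisymm _ (R.six_le_faceWeight hn f)
  have h := R.sum_boundaryFinset_add f
  by_cases hm : ∃ d, IsMatchingDart d ∧ R.faceOf d = f
  · obtain ⟨d, hd, rfl⟩ := hm
    obtain ⟨e, hne, he, hed⟩ := R.exists_other_matching hd
    have h4 := (hR (R.faceOf d)).1 ⟨d, rfl, hd⟩
    -- Two matching darts bring the weight of a quadrilateral down to at most `2 * 4 - 2`.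
    have hcard : 1 < ((R.boundaryFinset (R.faceOf d)).filter IsMatchingDart).card :=
      Finset.one_lt_card.2 ⟨d, by simp [mem_boundaryFinset, hd], e,
        by simp [mem_boundaryFinset, hed, he], hne.symm⟩
    omega
  · have h3 := (hR f).2 (fun ⟨d, hd, hd'⟩ => hm ⟨d, hd', hd⟩)
    omega

noncomputable instance : Fintype R.Face := by
  classical
  exact Fintype.ofSurjective R.faceOf R.exists_faceOf

theorem sum_faceWeight (hn : 0 < n) :
    ∑ f : R.Face, ∑ d ∈ R.boundaryFinset f, dartWeight d + 2 * n = 4 * n * n := by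
  classical
  rw [← sum_dartWeight hn]
  congr 1
  rw [← Finset.sum_fiberwise Finset.univ R.faceOf]
  exact Finset.sum_congr rfl fun f _ => Finset.sum_congr (by simp [boundaryFinset]) fun _ _ => rfl

theorem hasGenus_iff (hn : 2 ≤ n) (g : ℕ) :
    R.HasGenus g ↔ 2 * (n : ℤ) - n * n + Fintype.card R.Face = 2 - 2 * g := by
  have h1 := prismGraph_connected (n := n) (by omega)
  have h2 : (prismGraph n).edgeSet.Nonempty := by
    have h := card_prismGraph_edgeSet (n := n) (by omega)
    by_contra hcon
    rw [Set.not_nonempty_iff_eq_empty] at hcon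
    rw [hcon] at h
    simp at h
    omega
  simp only [HasGenus, h1, h2, true_and, card_prismGraph_edgeSet (show 0 < n by omega),
    Nat.card_eq_fintype_card]
  simp [mul_comm]

/-- Six times the number of faces is at most the total weight `4 n² - 2 n`; the rest is Euler's
equation. -/
theorem HasGenus.le (hn : 2 ≤ n) {g : ℕ} (h : R.HasGenus g) :
    ((n : ℤ) - 2) * (n - 3) ≤ 6 * g := by
  rw [hasGenus_iff R hn] at h
  have h1 := R.sum_faceWeight (by omega)
  have h2 : ∑ f : R.Face, 6 ≤ ∑ f : R.Face, ∑ d ∈ R.boundaryFinset f, dartWeight d :=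
    Finset.sum_le_sum fun f _ => R.six_le_faceWeight hn f
  simp only [Finset.sum_const, Finset.card_univ, smul_eq_mul] at h2
  zify at h1 h2
  linarith

theorem IsSnug.hasGenus (hn : 2 ≤ n) (hR : R.IsSnug) {g : ℕ}
    (hg : ((n : ℤ) - 2) * (n - 3) = 6 * g) : R.HasGenus g := by
  rw [hasGenus_iff R hn]
  have h1 := R.sum_faceWeight (by omega)
  rw [Finset.sum_congr rfl fun f _ => IsSnug.faceWeight_eq R hn hR f] at h1
  simp only [Finset.sum_const, Finset.card_univ, smul_eq_mul] at h1
  zify at h1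
  linarith

end Prism

end RotationSystem

end SimpleGraph

/-! ### The snug embedding made of a triple system and its mirror image. -/

namespace SimpleGraph

section Construction

variable {n : ℕ}

/-- The neighbour of a prism vertex with a given code: `some w` stands for the vertex `w` in the
same copy of the complete graph, `none` for the matching edge. -/
def codeNeighbor (x : Fin n × Fin 2) : Option (Fin n) → Fin n × Fin 2
  | some w => (w, x.2)
  | none => (x.1, x.2 + 1)

theorem adj_codeNeighbor (x : Fin n × Fin 2) {c : Option (Fin n)} (hc : c ≠ some x.1) :
    (prismGraph n).Adj x (codeNeighbor x c) := by
  rw [prismGraph_adj]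
  cases c with
  | none => simp [codeNeighbor]
  | some w => exact Or.inl ⟨fun h => hc (by rw [h]; rfl), rfl⟩

/-- The dart leaving `x` with code `c` (the matching dart for the invalid code). -/
def codeDart (x : Fin n × Fin 2) (c : Option (Fin n)) : (prismGraph n).Dart :=
  if hc : c ≠ some x.1 then ⟨(x, codeNeighbor x c), adj_codeNeighbor x hc⟩
  else ⟨(x, codeNeighbor x none), adj_codeNeighbor x (by simp)⟩

/-- The code of a dart. -/
def dartCode (d : (prismGraph n).Dart) : Option (Fin n) :=
  if d.fst.1 = d.snd.1 then none else some d.snd.1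

theorem fst_codeDart (x : Fin n × Fin 2) (c : Option (Fin n)) : (codeDart x c).fst = x := by
  unfold codeDart
  split_ifs <;> rfl

theorem snd_codeDart {x : Fin n × Fin 2} {c : Option (Fin n)} (hc : c ≠ some x.1) :
    (codeDart x c).snd = codeNeighbor x c := by
  unfold codeDart
  rw [dif_pos hc]

theorem dartCode_ne (d : (prismGraph n).Dart) : dartCode d ≠ some d.fst.1 := by
  unfold dartCode
  split_ifs with h
  · simp
  · simpa using Ne.symm h

theorem dartCode_codeDart {x : Fin n × Fin 2} {c : Option (Fin n)} (hc : c ≠ some x.1) :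
    dartCode (codeDart x c) = c := by
  unfold dartCode
  rw [fst_codeDart, snd_codeDart hc]
  cases c with
  | none => simp [codeNeighbor]
  | some w =>
    have : x.1 ≠ w := fun h => hc (by rw [h])
    simp [codeNeighbor, this]

theorem codeDart_dartCode {x : Fin n × Fin 2} (d : (prismGraph n).Dart) (h : d.fst = x) :
    codeDart x (dartCode d) = d := by
  subst h
  ext1
  refine Prod.ext (fst_codeDart _ _) ?_
  rw [snd_codeDart (dartCode_ne d)]
  have h := prismGraph_adj.1 d.adj
  unfold dartCode
  split_ifs with h1
  · have h2 : ∀ i j : Fin 2, i ≠ j → i + 1 = j := by decide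
    exact Prod.ext h1 (h2 _ _ (by tauto))
  · exact Prod.ext rfl (by simp only [codeNeighbor]; tauto)

theorem symm_codeDart_some {v w : Fin n} {i : Fin 2} (h : v ≠ w) :
    (codeDart (v, i) (some w)).symm = codeDart (w, i) (some v) := by
  have h1 : some w ≠ some (v, i).1 := by simpa using h.symm
  have h2 : some v ≠ some (w, i).1 := by simpa using h
  ext1
  refine Prod.ext ?_ ?_
  · change (codeDart _ _).snd = (codeDart _ _).fst
    rw [snd_codeDart h1, fst_codeDart]; rfl
  · change (codeDart _ _).fst = (codeDart _ _).snd
    rw [snd_codeDart h2, fst_codeDart]; rfl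

theorem symm_codeDart_none {v : Fin n} {i : Fin 2} :
    (codeDart (v, i) none).symm = codeDart (v, i + 1) none := by
  ext1
  refine Prod.ext ?_ ?_
  · change (codeDart _ _).snd = (codeDart _ _).fst
    rw [snd_codeDart (by simp), fst_codeDart]; rfl
  · change (codeDart _ _).fst = (codeDart _ _).snd
    rw [snd_codeDart (by simp), fst_codeDart]
    have : ∀ i : Fin 2, i + 1 + 1 = i := by decide
    simp [codeNeighbor, this]

variable (T : Option (Fin n) → Option (Fin n) → Option (Fin n))

/-- The rotation of codes at the prism vertex `(v, i)`: the link of `v` for `i = 0` and its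
inverse for `i = 1`. -/
def codeRot (x : Fin n × Fin 2) (c : Option (Fin n)) : Option (Fin n) :=
  if x.2 = 0 then T c (some x.1) else T (some x.1) c

variable {T}

theorem codeRot_ne (hT : IsTripleSystem T) {x : Fin n × Fin 2} {c : Option (Fin n)}
    (hc : c ≠ some x.1) : codeRot T x c ≠ some x.1 := by
  unfold codeRot
  split_ifs
  · exact hT.ne_right _ _ hc
  · exact hT.ne_left _ _ hc.symm

/-- The rotation system of the prism given by a triple system. -/
def prismRotation (hT : IsTripleSystem T) (hlink : ∀ v, LinkConnected T (some v)) :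
    RotationSystem (prismGraph n) where
  rot :=
    { toFun := fun d => codeDart d.fst (codeRot T d.fst (dartCode d))
      -- The two copies have mutually inverse rotations, so the inverse at `(v, i)` is the rotation
      -- at `(v, i + 1)`.
      invFun := fun d => codeDart d.fst (codeRot T (d.fst.1, d.fst.2 + 1) (dartCode d))
      left_inv := fun d => by
        have hc := dartCode_ne d
        have h1 := codeRot_ne hT hc
        simp only [fst_codeDart, dartCode_codeDart h1]
        have h2 : codeRot T (d.fst.1, d.fst.2 + 1) (codeRot T d.fst (dartCode d)) = dartCode d := by
          have : ∀ i : Fin 2, i = 0 ∨ i = 1 := by decide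
          rcases this d.fst.2 with h | h
          · simpa [codeRot, h] using hT.rotate _ _ hc
          · simpa [codeRot, h] using hT.rotate' hc.symm
        rw [h2, codeDart_dartCode _ rfl]
      right_inv := fun d => by
        have hc := dartCode_ne d
        have h1 : codeRot T (d.fst.1, d.fst.2 + 1) (dartCode d) ≠ some d.fst.1 :=
          codeRot_ne (x := (d.fst.1, d.fst.2 + 1)) hT hc
        simp only [fst_codeDart, dartCode_codeDart h1]
        have h2 : codeRot T d.fst (codeRot T (d.fst.1, d.fst.2 + 1) (dartCode d)) = dartCode d := by
          have : ∀ i : Fin 2, i = 0 ∨ i = 1 := by decide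
          rcases this d.fst.2 with h | h
          · simpa [codeRot, h] using hT.rotate' hc.symm
          · simpa [codeRot, h] using hT.rotate _ _ hc
        rw [h2, codeDart_dartCode _ rfl] }
  fst_rot := fun d => fst_codeDart _ _
  sameCycle := fun d e hde => by
    set R : Equiv.Perm (prismGraph n).Dart := _
    change R.SameCycle d e
    have hR : ∀ d, R d = codeDart d.fst (codeRot T d.fst (dartCode d)) := fun _ => rfl
    have hstep : ∀ c, c ≠ some d.fst.1 →
        R (codeDart d.fst c) = codeDart d.fst (codeRot T d.fst c) := fun c hc => by
      rw [hR, fst_codeDart, dartCode_codeDart hc]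
    -- Link connectedness is applied to the relation of lying in the same cycle of the rotation,
    -- pulled back to codes.
    have key := hlink d.fst.1
      ⟨fun a b => R.SameCycle (codeDart d.fst a) (codeDart d.fst b),
        fun _ => Equiv.Perm.SameCycle.refl _ _, fun h => h.symm, fun h h' => h.trans h'⟩ ?_
      (dartCode d) (dartCode e) (dartCode_ne d) (hde ▸ dartCode_ne e)
    · change R.SameCycle _ _ at key
      rwa [codeDart_dartCode _ rfl, codeDart_dartCode _ hde.symm] at key
    · intro a ha
      change R.SameCycle _ _
      have : ∀ i : Fin 2, i = 0 ∨ i = 1 := by decide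
      rcases this d.fst.2 with h | h
      · have h1 := hstep a ha
        have h2 : codeRot T d.fst a = T a (some d.fst.1) := by simp [codeRot, h]
        rw [← h2, ← h1]
        exact Equiv.Perm.sameCycle_apply_right.2 (Equiv.Perm.SameCycle.refl _ _)
      -- In the mirrored copy the link is traversed backwards, which has the same orbits.
      · have h1 := hstep _ (hT.ne_right _ _ ha)
        have h2 : codeRot T d.fst (T a (some d.fst.1)) = a := by
          simpa [codeRot, h] using hT.rotate a _ ha
        rw [h2] at h1
        rw [← h1]
        exact Equiv.Perm.sameCycle_apply_left.2 (Equiv.Perm.SameCycle.refl _ _)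

variable (hT : IsTripleSystem T) (hlink : ∀ v, LinkConnected T (some v))

theorem prismRotation_rot {x : Fin n × Fin 2} {c : Option (Fin n)} (hc : c ≠ some x.1) :
    (prismRotation hT hlink).rot (codeDart x c) = codeDart x (codeRot T x c) := by
  change codeDart _ _ = _
  rw [fst_codeDart, dartCode_codeDart hc]

theorem faceNext_codeDart_some {v w : Fin n} (i : Fin 2) (h : v ≠ w) :
    (prismRotation hT hlink).faceNext (codeDart (v, i) (some w)) =
      codeDart (w, i) (codeRot T (w, i) (some v)) := by
  rw [RotationSystem.faceNext_apply, symm_codeDart_some h, prismRotation_rot]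
  simpa using h

theorem faceNext_codeDart_none (v : Fin n) (i : Fin 2) :
    (prismRotation hT hlink).faceNext (codeDart (v, i) none) =
      codeDart (v, i + 1) (codeRot T (v, i + 1) none) := by
  rw [RotationSystem.faceNext_apply, symm_codeDart_none, prismRotation_rot]
  simp

theorem exists_codeDart (d : (prismGraph n).Dart) :
    ∃ v i, d = codeDart (v, i) none ∧ IsMatchingDart d ∨
      ∃ w, v ≠ w ∧ d = codeDart (v, i) (some w) := by
  refine ⟨d.fst.1, d.fst.2, ?_⟩
  by_cases h : IsMatchingDart d
  · refine Or.inl ⟨?_, h⟩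
    conv_lhs => rw [← codeDart_dartCode d rfl, show dartCode d = none from if_pos h]
  · refine Or.inr ⟨d.snd.1, h, ?_⟩
    conv_lhs => rw [← codeDart_dartCode d rfl, show dartCode d = some d.snd.1 from if_neg h]

theorem isMatchingDart_codeDart_none (x : Fin n × Fin 2) :
    IsMatchingDart (codeDart x none) := by
  unfold IsMatchingDart
  rw [fst_codeDart, snd_codeDart (by simp)]
  rfl

/-- A point different from `none` and `some v` is some other vertex. -/
theorem exists_some_of_ne {o : Option (Fin n)} {v : Fin n} (h1 : o ≠ none) (h2 : o ≠ some v) :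
    ∃ u, o = some u ∧ v ≠ u := by
  obtain ⟨u, rfl⟩ := Option.ne_none_iff_exists'.1 h1
  exact ⟨u, rfl, fun h => h2 (by rw [h])⟩

/-- Here `none` is the deleted point `p`. A triple through `p` and its mirror image close up to one
quadrilateral across two matching edges; any other triple remains a triangle in each copy. -/
theorem prismRotation_isSnug (hn : 2 ≤ n) : (prismRotation hT hlink).IsSnug := by
  set R := prismRotation hT hlink
  have hrot := R.prism_rot_ne hn
  intro f
  constructor
  · rintro ⟨d, rfl, hd⟩
    apply R.numSides_eq_four hrot
    obtain ⟨v, i, ⟨rfl, -⟩ | ⟨w, hvw, rfl⟩⟩ := exists_codeDart d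
    · have hi : i = 0 ∨ i = 1 := (show ∀ i : Fin 2, i = 0 ∨ i = 1 by decide) i
      have hv : (none : Option (Fin n)) ≠ some v := by simp
      rcases hi with rfl | rfl
      -- For the triple `(v, p, u)` the walk visits `(v, 0)`, `(v, 1)`, `(u, 1)`, `(u, 0)` and
      -- closes.
      · obtain ⟨u, hu, hvu⟩ := exists_some_of_ne (hT.ne_right _ _ hv.symm) (hT.ne_left _ _ hv.symm)
        have h1 := hT.rotate _ _ hv.symm
        have h2 := hT.rotate' hv.symm
        rw [hu] at h1 h2
        rw [faceNext_codeDart_none]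
        simp only [codeRot, zero_add, one_ne_zero, if_false, hu]
        rw [faceNext_codeDart_some _ _ _ hvu]
        simp only [codeRot, one_ne_zero, if_false, h2]
        rw [faceNext_codeDart_none]
        simp only [codeRot, show (1 : Fin 2) + 1 = 0 from rfl, if_true, h1]
        rw [faceNext_codeDart_some _ _ _ hvu.symm]
        simp only [codeRot, if_true, h2]
      · obtain ⟨u, hu, hvu⟩ := exists_some_of_ne (hT.ne_left _ _ hv) (hT.ne_right _ _ hv)
        have h1 := hT.rotate _ _ hv
        have h2 := hT.rotate' hv
        rw [hu] at h1 h2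
        rw [faceNext_codeDart_none]
        simp only [codeRot, show (1 : Fin 2) + 1 = 0 from rfl, if_true, hu]
        rw [faceNext_codeDart_some _ _ _ hvu]
        simp only [codeRot, if_true, h1]
        rw [faceNext_codeDart_none]
        simp only [codeRot, zero_add, one_ne_zero, if_false, h2]
        rw [faceNext_codeDart_some _ _ _ hvu.symm]
        simp only [codeRot, one_ne_zero, if_false, h1]
    · exfalso
      unfold IsMatchingDart at hd
      rw [fst_codeDart, snd_codeDart (by simpa using hvw.symm)] at hd
      exact hvw hd
  · intro hm
    obtain ⟨d, rfl⟩ := R.exists_faceOf f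
    apply R.numSides_eq_three hrot
    obtain ⟨v, i, ⟨rfl, hd⟩ | ⟨w, hvw, rfl⟩⟩ := exists_codeDart d
    · exact absurd ⟨_, rfl, hd⟩ hm
    · have hvw' : some v ≠ some w := by simpa using hvw
      have hwv' : some w ≠ some v := hvw'.symm
      have h1 : R.faceNext (codeDart (v, i) (some w)) =
        codeDart (w, i) (codeRot T (w, i) (some v)) := faceNext_codeDart_some _ _ _ hvw
      -- The third point is not `p`, since otherwise the face would continue along a matching edge.
      have h2 : codeRot T (w, i) (some v) ≠ none := fun h => by
        rw [h] at h1
        exact hm ⟨_, R.faceOf_faceNext _, h1 ▸ isMatchingDart_codeDart_none _⟩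
      have hi : i = 0 ∨ i = 1 := (show ∀ i : Fin 2, i = 0 ∨ i = 1 by decide) i
      rw [h1]
      rcases hi with rfl | rfl
      · simp only [codeRot, if_true] at h2 ⊢
        obtain ⟨u, hu, hvu⟩ := exists_some_of_ne h2 (hT.ne_left _ _ hvw')
        have hwu : w ≠ u := fun h => hT.ne_right _ _ hvw' (by rw [hu, h])
        have h3 := hT.rotate _ _ hvw'
        have h4 := hT.rotate' hvw'
        rw [hu] at h3 h4 ⊢
        rw [faceNext_codeDart_some _ _ _ hwu]
        simp only [codeRot, if_true, h3]
        rw [faceNext_codeDart_some _ _ _ hvu.symm]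
        simp only [codeRot, if_true, h4]
      · simp only [codeRot, one_ne_zero, if_false] at h2 ⊢
        obtain ⟨u, hu, hvu⟩ := exists_some_of_ne h2 (hT.ne_right _ _ hwv')
        have hwu : w ≠ u := fun h => hT.ne_left _ _ hwv' (by rw [hu, h])
        have h3 := hT.rotate _ _ hwv'
        have h4 := hT.rotate' hwv'
        rw [hu] at h3 h4 ⊢
        rw [faceNext_codeDart_some _ _ _ hwu]
        simp only [codeRot, one_ne_zero, if_false, h4]
        rw [faceNext_codeDart_some _ _ _ hvu.symm]
        simp only [codeRot, one_ne_zero, if_false, h3]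

end Construction

theorem isMinGenus_of_isSnug {n g : ℕ} (hn : 2 ≤ n) (hg : ((n : ℤ) - 2) * (n - 3) = 6 * g)
    {R : RotationSystem (prismGraph n)} (hR : R.IsSnug) : (prismGraph n).IsMinGenus g := by
  refine ⟨⟨R, hR.hasGenus R hn hg⟩, ?_⟩
  rintro h ⟨R', hR'⟩
  have := hR'.le R' hn
  rw [hg] at this
  exact_mod_cast (by linarith : (g : ℤ) ≤ h)

end SimpleGraph

/-! ### Triple systems with one unrestricted link, and their relabelling. -/

/-- A triple system on `W` all of whose links except that of `p` are connected. -/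
def ExistsTripleSystem (n : ℕ) : Prop :=
  ∃ (W : Type) (p : W) (T : W → W → W), Finite W ∧ Nat.card W = n + 1 ∧ IsTripleSystem T ∧
    ∀ v, v ≠ p → LinkConnected T v

theorem IsTripleSystem.congr {W W' : Type*} {T : W → W → W} (hT : IsTripleSystem T)
    (e : W' ≃ W) : IsTripleSystem fun x y => e.symm (T (e x) (e y)) where
  ne_left x y h h' := hT.ne_left _ _ (e.injective.ne h) ((e.symm_apply_eq).1 h')
  ne_right x y h h' := hT.ne_right _ _ (e.injective.ne h) ((e.symm_apply_eq).1 h')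
  rotate x y h := by simp [hT.rotate _ _ (e.injective.ne h)]

theorem LinkConnected.congr {W W' : Type*} {T : W → W → W} (e : W' ≃ W) {v : W'}
    (h : LinkConnected T (e v)) : LinkConnected (fun x y => e.symm (T (e x) (e y))) v := by
  intro r hr x y hx hy
  have := h (r.comap e.symm) (fun a ha => ?_) (e x) (e y) (e.injective.ne hx) (e.injective.ne hy)
  · simpa [Setoid.comap_rel] using this
  · have h1 := hr (e.symm a) (fun h' => ha (by rw [← h']; simp))
    simpa [Setoid.comap_rel] using h1

theorem exists_isSnug {n : ℕ} (hn : 2 ≤ n) (h : ExistsTripleSystem n) :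
    ∃ R : SimpleGraph.RotationSystem (SimpleGraph.prismGraph n), R.IsSnug := by
  classical
  obtain ⟨W, p, T, hfin, hcard, hT, hlink⟩ := h
  have := Fintype.ofFinite W
  have hc : Fintype.card (Option (Fin n)) = Fintype.card W := by
    rw [← Nat.card_eq_fintype_card (α := W), hcard]; simp
  let e0 : Option (Fin n) ≃ W := Fintype.equivOfCardEq hc
  -- The swap sends `none` to `p`, so that `p` is the point replaced by the matching edges.
  let e : Option (Fin n) ≃ W := e0.trans (Equiv.swap (e0 none) p)
  have he : e none = p := by simp [e]
  refine ⟨SimpleGraph.prismRotation (hT.congr e) fun v => (hlink (e (some v)) ?_).congr e,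
    SimpleGraph.prismRotation_isSnug _ _ hn⟩
  rw [← he]
  exact e.injective.ne (by simp)

/-! ### The cases `s ≤ 6`: tables of triples checked by computation. -/

/-- The `y`-th digit in base `128` of the `x`-th number of a list. -/
def rowEntry (rows : List ℕ) (x y : ℕ) : ℕ := rows.getD x 0 >>> (7 * y) % 128

/-- The rows define a triple system on `{0, …, N - 1}`. -/
def checkTriples (rows : List ℕ) (N : ℕ) : Bool :=
  (List.range N).all fun x => (List.range N).all fun y => x == y ||
    (rowEntry rows x y).blt N && rowEntry rows x y != x && rowEntry rows x y != y &&
      rowEntry rows y (rowEntry rows x y) == x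

/-- The set of points, as a bit mask, reached from `a` by at most `k` steps in the link of `v`. -/
def orbitMask (rows : List ℕ) (v : ℕ) : ℕ → ℕ → ℕ
  | 0, a => 1 <<< a
  | k + 1, a => 1 <<< a ||| orbitMask rows v k (rowEntry rows a v)

/-- All links but the last one have a single orbit. -/
def checkLinks (rows : List ℕ) (N : ℕ) : Bool :=
  (List.range (N - 1)).all fun v =>
    orbitMask rows v (N - 2) (if v == 0 then 1 else 0) ||| 1 <<< v == 2 ^ N - 1

theorem orbitMask_sound (rows : List ℕ) (v : ℕ) (r : Setoid ℕ) (P : ℕ → Prop)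
    (h : ∀ a, P a → P (rowEntry rows a v) ∧ r a (rowEntry rows a v)) (k a x : ℕ) (ha : P a)
    (hx : (orbitMask rows v k a).testBit x) : r a x := by
  have hbit : ∀ a, (1 <<< a).testBit x → r a x := fun a h => by
    rw [Nat.one_shiftLeft, Nat.testBit_two_pow] at h
    rw [of_decide_eq_true h]
  induction k generalizing a with
  | zero => exact hbit a hx
  | succ k ih =>
    rw [orbitMask, Nat.testBit_or, Bool.or_eq_true] at hx
    rcases hx with hx | hx
    · exact hbit a hx
    · exact r.trans (h a ha).2 (ih _ (h a ha).1 hx)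

/-- The exceptional point is the last one. A link on `N - 1` points is a single orbit if `N - 2`
steps from one starting point visit all of them, and the mask records the visited points. -/
theorem existsTripleSystem_of_rows {n : ℕ} (rows : List ℕ) (hn : 1 < n)
    (h1 : checkTriples rows (n + 1) = true) (h2 : checkLinks rows (n + 1) = true) :
    ExistsTripleSystem n := by
  set N := n + 1 with hN
  have key : ∀ x y, x < N → y < N → x ≠ y → rowEntry rows x y < N ∧ rowEntry rows x y ≠ x ∧
      rowEntry rows x y ≠ y ∧ rowEntry rows y (rowEntry rows x y) = x := by
    intro x y hx hy hxy
    simp only [checkTriples, List.all_eq_true, List.mem_range] at h1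
    have := h1 x hx y hy
    simpa [hxy, and_assoc] using this
  have hT : ∀ x y : Fin N, x ≠ y → rowEntry rows x y < N := fun x y h =>
    (key x y x.2 y.2 (Fin.val_ne_of_ne h)).1
  let T : Fin N → Fin N → Fin N := fun x y => if h : x ≠ y then ⟨rowEntry rows x y, hT x y h⟩ else x
  have hTv : ∀ x y, x ≠ y → (T x y : ℕ) = rowEntry rows x y := fun x y h => by simp [T, h]
  have hsys : IsTripleSystem T := by
    have h3 : ∀ x y, x ≠ y → T x y ≠ y := fun x y h h' =>
      (key x y x.2 y.2 (Fin.val_ne_of_ne h)).2.2.1 (by rw [← hTv x y h, h'])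
    refine ⟨fun x y h h' => ?_, h3, fun x y h => ?_⟩
    · exact (key x y x.2 y.2 (Fin.val_ne_of_ne h)).2.1 (by rw [← hTv x y h, h'])
    · ext
      rw [hTv _ _ (h3 x y h).symm, hTv x y h]
      exact (key x y x.2 y.2 (Fin.val_ne_of_ne h)).2.2.2
  refine ⟨Fin N, Fin.last n, T, inferInstance, by simp [hN], hsys, fun v hv => ?_⟩
  intro r hr
  have hvn : (v : ℕ) < N - 1 := by
    have := Fin.val_lt_last hv
    omega
  simp only [checkLinks, List.all_eq_true, List.mem_range] at h2
  have hmask := h2 v hvn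
  rw [beq_iff_eq] at hmask
  set a0 : ℕ := if (v : ℕ) == 0 then 1 else 0 with ha0
  have ha0' : a0 < N ∧ a0 ≠ v := by
    rw [ha0]
    split_ifs with h
    · have := beq_iff_eq.1 h
      omega
    · have : (v : ℕ) ≠ 0 := fun h' => h (beq_iff_eq.2 h')
      omega
  -- The relation is extended to all natural numbers; the value `v` beyond `N` is arbitrary, as the
  -- orbit stays below `N`.
  let r' : Setoid ℕ := r.comap fun x => if h : x < N then ⟨x, h⟩ else v
  have hr' : ∀ a, (a < N ∧ a ≠ v) → (rowEntry rows a v < N ∧ rowEntry rows a v ≠ v) ∧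
      r' a (rowEntry rows a v) := by
    rintro a ⟨h, hav⟩
    have hk := key a v h v.2 hav
    refine ⟨⟨hk.1, hk.2.2.1⟩, ?_⟩
    have := hr ⟨a, h⟩ (fun h' => hav (by rw [← h']))
    simp only [r', Setoid.comap_rel, h, hk.1, dif_pos]
    convert this
    exact (hTv ⟨a, h⟩ v (fun h' => hav (by rw [← h']))).symm
  have hall : ∀ x : Fin N, x ≠ v → r' a0 x := by
    intro x hx
    refine orbitMask_sound rows v r' (fun a => a < N ∧ a ≠ v) hr' (N - 2) a0 x ha0' ?_
    have hx' := congrArg (fun k => k.testBit (x : ℕ)) hmask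
    have hvx : ¬ (v : ℕ) = x := fun h => hx (Fin.ext h.symm)
    simpa [Nat.one_shiftLeft, Nat.testBit_two_pow, hvx] using hx'
  intro x y hx hy
  have := r'.trans (r'.symm (hall x hx)) (hall y hy)
  simpa [r', Setoid.comap_rel] using this

/-- A triple system on `18` points; the entry `T x y` is the `y`-th digit in base `128` of the
`x`-th number. -/
def tripleRows18 : List ℕ := [
  8687363590496940294880470408024408320,
  9990348047157586174878443716487413768,
  6007898516159831768451294957993461377,
  4724993313045431896372568197550933517,
  9361954642476051007457204256844597258,
  706683243617217077721568967445971849,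
  2056354638079832980309862259158631694,
  2710830281003786071520095065342100226,
  3992962202455689708662312255990333452,
  5333058375786506976779594166211725200,
  7321629490841700636800855631615738373,
  67621900280491421022088749520077959,
  6734571938430823631254668268076713734,
  3354510259864355645150205531178156433,
  1365898617127220951554571839721375108,
  10633826831067066202253672006488819843,
  7976058554725320035770056988921332751,
  77926285658840299290505703124599435]

theorem existsTripleSystem_17 : ExistsTripleSystem 17 :=
  existsTripleSystem_of_rows tripleRows18 (by norm_num) (by decide +kernel) (by decide +kernel)

/-- A triple system on `30` points; the entry `T x y` is the `y`-th digit in base `128` of the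
`x`-th number. -/
def tripleRows30 : List ℕ := [
  360577278376978898457848084783665994382448775217825011137317760,
  90298499257226620539185093227920202858404573741282630950141971,
  13363343211000484441236060295578126820780404957140391947144336,
  244475189103220597667651013071820060402564225510753815132196356,
  218651162300054943511828261565822947811705551438360828566602759,
  349418804604733977734873783655892312526179613698907580561557770,
  298403296236110416261925047598780266796043596802556156765605148,
  104761720254615114886662643924734837796183395243335787146038929,
  1520714635204007807668518841398329218020160284753545599747205,
  155281417083551764480481458094895402141527926720893962009397899,
  66498886710824202516954961360967182917728862303605859557982615,
  321801904517963511983275364983816070792336266130422029061705112,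
  233521671285306509328157170272888268746385812078574905344625044,
  116820064151956781479940200598542631515246200894063893641694230,
  77955395229671791832452586434076249186458445456513736521188995,
  180683370008035642167570626353212468080869327940264619980228617,
  193753057085356680501639509911270942840316354063145097821684358,
  40592497320227877714266514787451917148344417200693969691002124,
  258433875408479991440230105391348001848370018651663788731991833,
  144029767346746106080447900051981276940197567909935492785897490,
  271173173453080069947261736122124647932270844991833900388239490,
  310339983796970512863806578621213195500552114944404708674339599,
  170035046331240567768086725756418767053409548247616699758659086,
  53030544380433691770947600147758213246688268297909010201593729,
  130268865055523492025897256870992382333601715671230839284450189,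
  207116251307842430609713510539744378310448192735378174898096666,
  28144170272886261120365380551846252955756086257587228069938587,
  336753954048987133585630559730125217189874448816370977658489621,
  282825921388330647357827903010154621103866938756236234362765853,
  4089232773586186269893180347480663052649560533437956653320]

theorem existsTripleSystem_29 : ExistsTripleSystem 29 :=
  existsTripleSystem_of_rows tripleRows30 (by norm_num) (by decide +kernel) (by decide +kernel)

/-- A triple system on `42` points; the entry `T x y` is the `y`-th digit in base `128` of the
`x`-th number. -/
def tripleRows42 : List ℕ := [
  7726540716618402817079627285511989600242633010323276485421514056126007885118896800846848,
  6962587575471426137077024248159450310776630082598257928540236185304431283982769659674662,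
  2057593348848870787616465114818064868827208993145127966750572965937481963163660985566881,
  5490165150180947856698363931763019879152267706220969781610761880306795572178729119860877,
  2535793676145864505945853224279489254224966447849015500577161612046861169660120189391767,
  2788079781367326975985234110779083395934037769475411931835090733352698231471031240135048,
  3050191750197771037574198224942625257900383617542562700758120289546735245378585402753306,
  7963380419238169496328949665870859050620843430753729087570227149772506751830706211734046,
  6739258338358274227238361833765071291298155901393138113698437583652874499583273643690916,
  5991513378152834190078093385660285582088653682929721799137905769013743499737070512950056,
  8734726331383064690327651891845469082315894155906178910761781825233459344374111135682068,
  8208249438962460411280510447510397656909998845211893086044987140667311987482146856305563,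
  6529479250538329124411997637523504919035249015458969308293041000889231891190008164993688,
  7239007177233503588636054701288994945908621242056074648237769303946088237181753748378377,
  9482459854218399433472906943472253741989888520557838804647382907595218502255525333845509,
  1008824288903379471881082729046517026412621816109628918336093111961517456203105322716569,
  8994999129388141529966477040404670865615153750929024728453424268005493394885246571414556,
  3768854986436000326517590053689435735288204980385905521599976786729209712567900571013767,
  7501056631341299059790278995623899383956467781612170121935536470286121081422560186712707,
  1289950048928945765374386879101372356155690643070152027298898108500080990844055296904326,
  825787969806440957909328272736796387257661825362255004816960723137633706430712120985365,
  9258991545044568515486100189194760006138146704584612332911892025784841391359511756933388,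
  8528715219508510767377995325930043609724552511588369709864676222533234292667150158156305,
  9958169363235878043253447751869715630990128754529506860520848702781206380124350288349067,
  567596186570445677819046994400637452436826014063749469774307614137266037310206450896144,
  2267615505230806543904949458501992142764265304348056393998094732232593713189786161956895,
  5278262232040555968452056200124956344395021065777799434545491528012490557514624925156640,
  1513445556948341328627092720832879408335953476730695545754587457846875753846923791436306,
  9758592155311267479163759729539438787356727123332833777611040974905773555276745514620046,
  3543431626931484048599025251204291829179269072811416579035543458628215290336915231445135,
  4015618409080612416449466502321161914513105877446908525136028465755475067493601404931076,
  4547882172241999320504950033299052991821104857369403027484892942109884091100064993513257,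
  4734561670920971215836217546987203938323103413657050801592896095073077880332448787009174,
  1775846237251197116114917434473577700155721077694788303267894554664582374040429081399178,
  299429028488905060436436688479289877344587356576071098000688146005628926053619985531299,
  5795483219896771518727410557716508421765025309375106109669059849545655594179901543550978,
  4231498061076192756863877537760327583831063844667440323782563936438882146952590433256231,
  15999154232977083966610008324176505507501967384014858453500439959706990753422535525523,
  6271147693202196017795849263138864779586539316507166905449845548377828529840534638215202,
  3240373516738707492718861637767595339662430265550457840349776968825379163751381406747037,
  4973766200077512767997285182478671292520715575920067423413320389900790371327214350828929,
  45108022906195681004765559474005300661440412858609365237775017636911793031943756845349]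

theorem existsTripleSystem_41 : ExistsTripleSystem 41 :=
  existsTripleSystem_of_rows tripleRows42 (by norm_num) (by decide +kernel) (by decide +kernel)

/-- A triple system on `54` points; the entry `T x y` is the `y`-th digit in base `128` of the
`x`-th number. -/
def tripleRows54 : List ℕ := [
  57883376183357674488894143419529610003998840448764397806947400016325811109903772039321339917544053250979386348672,
  24927809580475536792376729303113819842649721819965766341298549337680240815264684563089268860841015501893225152539,
  20901173637313224673931122748597520594367207645649057993755570587861399959800237390509807694719028036438845297183,
  174244262577998406397513005933654299834083816030997741358218680445907873780743938776929635838849531496057497131026,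
  202278007990288529815872670581248505340838934402962297889557610607322973613015021984416247773972311769373488270004,
  101697231060741640613112516460647149438779466750575057999370828440401828741797397615994794660321327790285056776840,
  183975760225452000969719667800087159439768960543256001915513621699556937481296138191499962127340695260433095902219,
  92376814949642795231709383340467711844664921779955472315571800122282921159714914379476911725105865132187574883843,
  154491301396880429191989816617712632154690500077659791130742482868070861358415319040369659685453699001484360909324,
  68177959574479747780986863185031759976348175694161477678943858447188320897230151827332715817580433072032942969522,
  139528483943564302324480217038153643255183771188437419373044281041685797611471711278870159630583146361779512481926,
  208328164808417101820514899447426080048520562986289116070774815464922375059532015460001857116652184888293200791974,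
  189013945756226631418734765233389387049247092777419904480215917115304547393545376565716348091111603928949078594613,
  232869784058892305180037909557622923080562521201368394069801845837998453399758516367603552812971567440136812186372,
  87303034872408874085936845536128398761338969086361740849348683142030718082862238818948503497823670189405162132267,
  77417654314441667901942495250186313308084524962834864915934631948431871507950904343424117914113054809315785510402,
  168763445112665784671884666698508908266567735232509409128419345926260374680676112358867149335269840702891595418908,
  179582575447288956904890064502626263027008181252966718408018793719586557732311838144698876806285895412835443412631,
  121493725051344883612837168874109072973652836760346871551821222355060597071068304998966780173985585642750051879962,
  9746516351011666240268489630496542864244320154092726433901555444068707178633432838356151218408087207137727841186,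
  218175298950326429052269164402187729444315921236596024596318743511674726664991444236847233349095885651669535802020,
  193675798856351279894319465812525089708940505296272287594714152787361447559363814275665986279156152949166744077999,
  164854844320909039611068130836026811217729915870539125487408318860701261988401499802482632413588876223766799468072,
  198556088082665293951891032623338736378551972836722894299108855807204683159507224084868462397611929658829971167763,
  45178620673613921671492421023394418079631420938003573249783234945248872525019616804267518073992622516753996057765,
  126454347080480120350304611011403883380027230767168787356885323380309751242464372459542083825177335256594245569428,
  97663290663234128017647779584887047251372412297250727751105415388056181837045085411021668732658100047239845614989,
  72759714294893332717108970031035038991204476535681681838871716372675929507957855210585793164658589855267736895493,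
  250757226924285453601955809540848582703790537467589735389686183228346767416331803449967180244156012168823244527274,
  117013861547434717409895074517690304678441849954529479784576911726291298202417429496063145929525741507771708004141,
  39429718555535865566243413398122505761697729864637826526154128738419520527950020809042577473416499701820411791121,
  212387845516845160342005912055124897203149645953520448030674577992762878287350347961963560888298832885241582981294,
  1703615664860274292630836700920676874980760437737324169802388311511150887324309213595571627214308359568290726297,
  82942123300313057280896735448796128985803982603085161258318077354714176138556127110520854171820563593507488466988,
  247071409530089613739459895888769536606246857079501600539543024108124372716312331723439302821735845189413585470869,
  5837371918455667043650428830799638079369504115885352470840854819042032428253764351234699962398815776040234423183,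
  106123986616866996494393739134066378888344257384753927543766871592939963001837068634256257856173614373629337815344,
  30702233527479282889723949552777207016536697309741739837887320513648493815210255147396553452740617274715369806096,
  111161284416457652589581455505933157360281480282559931776201261099394694490450703104073597028403688931472152610951,
  149187138132499655082935358755565389798399583778645687248838025040273865248306099966918398110399729173880084387721,
  159629577050151296969340821178303733631809085834456473387054197850332315854738319472862526917116396896695853237386,
  131790641275507252153159754610928782741812347810739611926861600313450523604530558562688801004658207938594745062657,
  221450327911284868212079302276924095907419999139849154314123443164340268126848295960502956542555450590894154583843,
  134910903120586654657648395874097915339238962670818246250010462837463947915954812553867779381850888290124245455153,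
  53401794902960124150318737306357827940190760036460359058458335140573324909951996872769855594208738470526257532327,
  237491465291625719470368007213695058313757564280973750002847157546450450100539234660443752234150905309184360090145,
  226400170889270683808003653000052750295901781348065795672076462172382508454781179990860675859554316909500564721694,
  144672585855291440523802481855189804742138750996452407934464330904531947451066857522011676082566611568647179898766,
  49227272103582660626107837237467605545454556721104801090972413502259905548368081672659218909064673072139230167318,
  15222716343442786794379050064264544159831383241127149151136532751893350474837517114589775999960333309212788677033,
  35224910089100811991907487751978349545088316451281586001581229255737238871896119096188368428607119936372684965784,
  240490771964121168770475455721424412579795232127667719640809452279316866652998922303923256186135756380917876884253,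
  62539689717775117566728242250157794440487065891930356643889201558462290806382347803634650786747108286686594450739,
  1062246159667448321683898285858471381208790924898709347184207441147615309542733060987038862669010119109263020448]

theorem existsTripleSystem_53 : ExistsTripleSystem 53 :=
  existsTripleSystem_of_rows tripleRows54 (by norm_num) (by decide +kernel) (by decide +kernel)

/-- A triple system on `66` points; the entry `T x y` is the `y`-th digit in base `128` of the
`x`-th number. -/
def tripleRows66 : List ℕ := [
  3358843628812232554836122245358058247695042021249052207128441911680891285424727526608633725813589051289971314913827008891477317540596783616,
  5146835965639689122809662250269081495063380962430351922748632085217155398859841028247510999738962105160810749742452958401389890597185486905,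
  2347173823594974772062597143513659478872084860955253830507737996299684087862345974096192503322827788530221108415104847829230796494885363494,
  2906237416828007028762087902601302405481999717296385679606828795342993905932930362730215796890810964066849606458976933582887620336786130336,
  1873376151384829456219942147631954502897801390633819997139990720515449698207336114084371920591487394332920577695617671308810506349220351116,
  1781074463950137056110730871381614419277386996491522833703136580429675488662244672325342749840317992831190340420260281159887140408657680518,
  2804969302965947044555607593156330978963296808458298613071400398196695866981956300579346989900148137174369518619812729658883303660891966338,
  107800529649171630235121734516822731917191260375825079260819884465822643778884563378187036136619770727380905962683152498402069247156229293,
  3303784259794404017603487525078990562301289066955689803645722834033107257287107435224877763946420739892054779513484712920599548228631336378,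
  2156025609558533360131383173601720787780537877761696088165485685007640457113420795126275610178030629511258975866784503730517423340904373678,
  1317902433270291933346057430187896862352680397162066436611713453455201143674931041478436648255671603543221413394978045537937632421696753332,
  5702079612682133636662643201759628571897538282602325107814798419082333906797101029294344170219717548861358139835993067122331405827718257287,
  3646875967758647975347721917413737907052973635504164744874621279356030811936945536341279308817890504120892030611648661424021990791791203880,
  3833542957239384612792006278564177572422475825819280112639656977890980020391106852088217664510170621119849717807615852946140553617715907648,
  4603816020148828604324599242164687324891574917646281938602104266156938608530940317918120996900835729055600776389851520958465964736833372945,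
  3928082297358222915534074061921020765740503414548166003575569152985243855445699865861416510175824507916680761024839295215195545543699939873,
  5339607386416349279776533583509983750197266961274246072114647994248593408466702902089695976903725106760836980397258797804725119319428734904,
  839647080062167309167430637850485299128631283806695629658011443269013724492735256767028468681026969592710350300321924702191610797075635346,
  413754678127222187947781969669225104371629417807691542321541063831002989819037640352092827173953105545038005846512642800721931877369715115,
  3093586382289995708557316672824394071185380208177967618476700992630766348554269447738092939765149797756481802007790866530933021782808904733,
  681787920698904350459002925341895700461258521896882075064694978589712165775456308704408552848546097458214179733859942615377356159508468028,
  3180271538262529366825518461329803311478859866474980489425190286653455301997543918931607640191153768809502307955224426294291121141666944319,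
  956026275957686280627503701765751082752962781500682343289645567526472500755523035571236639928731932167435922072974614207997299500396396834,
  212436646611801290754607843396100793269181720934923376539306943901329674514792641249680551254134204858498444542884832036627001237093665305,
  4756014410857299325707172150001153958387295401923270875344758327336140596376504703026582810152241587257222284280055182085496106483534187807,
  316222323951258552969016459303691231542219105678404129275851256558650017853285366255724671608091892569238064879626224915939936506035066543,
  3749869625849258087275087463017928953862353691966546298815600931838078267103711744579783619049986454692314710910086961042563463017678133262,
  2262140734355901058010531784549902061341149918789511827841516345824748250544329316235118325695247484677408057392614081018019286947487222153,
  1434781557337122717175745957311005760469579548618971841200651218745850359869528982226638429274388340690870593911863749546197685324608933298,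
  1686614444066114510186645657616627576706350777412814085856477330937186212249330234992637722601119533510360296163803671636357462747847333765,
  4218000706205599101238566010299331738020243175786098590135311180423893372473448747014475708511192983620702004571841207893377409605721524016,
  1030739122852518503340101416978211254559451882258526447035697469223619812158148321479707651287429259915657550832886673937440490738623469367,
  5521960831777793296513979515010830917297343869605418684206586844869301439865558395155275148479561432493485916970227531117752597730588089877,
  1242901864686287689333576684982774834114865136325844132322570150032064160870460026520665562721526194678195306019044098954639340172133501706,
  5998152427397180865639396088879732479273319686100495333443788745804563032929512357086569167660872715158456546558365111277259574143858791205,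
  2081769385348876439274391072881520095433797886778471316780556225679879812403592603536695552937727833957222766648622727115498230995235969800,
  4652037270793446279390396684266529395804375936528096031868476431465210454005107081231055794156763819965986401602695413171795756266168370497,
  2605991977495013719914508712172489217799924994277736022354864412578875456952736120167680010142712813711371423593849059193822418658739083573,
  2529422284680495511528105491985565907113915927633941632372658062008284552535277689332196779963933783610568547291904149605207455134421881238,
  2456831136827095098018155199196196435872634544329623523661165561225704110940432525556269391074478661284341623939762178961127242537242083731,
  597032597163141249280422808112562080972544815006815244929554646524076138739220966551801907497773548937553545600028769061750342953608990506,
  4382969325161407731229471287968175975285976234449367982884741852896430520770536523790468414613521889535048869440130654546138272386016698379,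
  4024541471762704613954804666792366112551586199478485742835231102806318399832978833662109288533520627287481767909500973046812089436892497431,
  1586742234554741994116919330824903648731143550560825337678786698729804283892427904997422266448556995648889206859942185901889271711465162755,
  4472409030739334849321629859531280889054997962217013826647666233425286599181503272646599657147987682411038989423018612788032686305353424547,
  5903447696506158888986008586923618588137539036005086595908759854993765652963130412218532348793096882801227601098649128452911517379802530964,
  5625294723875750768884687686525588034296361097173970453961526177736767245390602339800736437614496932897733169683738906897203196822431336719,
  2707076896375312453390776292677427279937507216979367213732022232813360507384615444642930623929276352209976929459705411980389890717552776123,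
  1998256005420378666983954972147184516729915724295325777660054884623051054937131755108966356846169073979795713261109706873266593957220583309,
  34246973654832025967978207570096983201587295500990667734463934051472955142347389736354776571332213933172920365937403870245881624958813851,
  1534545280216136225760256310396270864533236762352810696636215429023719118705215002442456806546208528420690584890311729783806876924254589494,
  4839417329268433912173150045473397674205663175852786203654832253892249948427594780952293236049242002659974576536450390821489177364846713758,
  3017369165066949000417348122248275102998572662129493915661261242412087357562420440886232545251382313607348096517720208708235428755659460481,
  468290092745094754020210006827224325111836722975022008592393620872465576304073365486080316688805169788208684040828208121663996203647717402,
  3539018082782214507901611490813989098959480512465436837468393330673209535172585474041606872328922741984031005927720270971658008966533336617,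
  3446743723245233221050644307071750540835047359655094411984764648453852696209726768404198146899967224117499316245799203930116580555635597479,
  4121541881232337055925564740655448949902905535880888571325278107186901032815879685327410788492760635790075220416190782942447610104925082685,
  5402208201857859051889774841432695652963143854249560067958860756552912439468618389745172603056243288597981074441765560574037834377354870808,
  5056028137713781251452894798868912159540028225956911390581031271685968332278922689943781685933182766030695633109631118736942106431736306704,
  4302216755799367991917511441550553736417106710909785203935958573750483407911398960720262007365382914250713741079178962530695339122912299198,
  1124658856158045543726186242768940111563028875191938645182975147893468748143544292517119909757807358005379541585361491193321089396361403652,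
  4966558031535262510959248126972822468783143187175342583353792240457281054383428623974508460263185280708041942795942545270616012435820380851,
  5229973733065527297049453547030310387844849320916523055959238905311132942162738234967231360426380697563498640913655179077780029922217052844,
  5808896026392844438522240495390859890245115737166941161852683169342924020857370140098421207243609241095306326142586111990839647967843258524,
  744567412862450908734699128649109567739830766203788493524852527410183199176691947531501569089347635634669877349789726328267804983847342756,
  24970844653773195832317073156422942761406743241066922926001728912001621583366853508769425391265590619770345482710388208647166626204337073]

theorem existsTripleSystem_65 : ExistsTripleSystem 65 :=
  existsTripleSystem_of_rows tripleRows66 (by norm_num) (by decide +kernel) (by decide +kernel)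

/-- A triple system on `78` points; the entry `T x y` is the `y`-th digit in base `128` of the
`x`-th number. -/
def tripleRows78 : List ℕ := [
  68782637833849034443799759774665555997825154870607713864248961014250949528229349268462403820948905935455337048226823607070328578650962095915629063124829445118526336,
  117775609711506835161559123027644348771949430511128691116807277324578530372152148689192985269613094111796566178260540296257770998597700942322986645465056679972798538,
  46993345182453340789686489223373649251891764396126965216387581376507570871474071208130756938065321152637835508211860118484590182518260065783672048818579353863460531,
  79185528857933366567387015661421925125437758127121463752625036312118900249989267290445911058285685185901038575029262351527007232192265578288227362263795226563124119,
  30808240848444457839002071792140617937145890198185205077648253514857583367280625232714705669671930247024401083843108801411301164667235815405151905666368513444563638,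
  58417469236069509188997035931272290816988683998256601454943253133786062760071372019555453420241230880607868481186470667022769676173239951324505206181816248782805667,
  85269814398628300053564965294246952326923664683789634769262795175471942155273601380915337082619361229130215354335012977489159605281964774832139406600543370777648146,
  127816411144070268040811243697404626411887165665025568356005028167616002209030777048887170703167533167198811319287158248163624930159467658600256564020499912872971137,
  115484408089793470327154088287932592730298425047224569329234054107236858381252498562839538708074515644218209958781349446000941517027003818457983969558752891987240003,
  27914952550086848188606056289384079027205961546746175451200470977826757279042239733026428838861318830372324675482947284848059322795597659149564265819576432182746908,
  8159450025970658511525815163669594162385803005697751209726516099156353812735002444877459629978651947010624873174384019464543459577638284838402336902419262969943089,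
  103281209757567094301910760576890344378281739047325317722956214741167092343353847549230803763954280212616566464179087822349676716159577177679361041994415578488030494,
  11265878181173656179559402848447148019944057678265110295020541878720588326275247956719902378360072215035998432221437241044250198507629923801525034816785832296831535,
  91837375985343926960476988497253291230879017450003702356972648731434795537650728548669167886196275294131725814825769958548614562880968926912051096032070045813313823,
  65196499863296064105989517956355986451914625623837779405358302900709102295990023787685743632536533650288093404399341311497690186782303788271377499662238955280205384,
  38120501281410953777194246851365856098553198096476436067441426072078464966495621491874608851181471502463068827510087249888232738464273064008727747766567905448233020,
  88362524005888498196951789758071510911330343325146450355796451627738907240481543494919051828057312262677516803600127928913221845123626710600601007321357831308694421,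
  112212242724577034052813176979913600169199698287367183223813155432923173662941547702283905757887083439981912312344500223438042550941205093515272838405621006087652760,
  54990013836965639731652306517319934835597036967759134599744245497910511341916139524273722169720948802548912860876679171602729370488007558130022041292432876562973378,
  40384942533176867487445408439176350032543407572399106687544246723309102358857760660584310957527702901944560290098191189411858466847036813098079443080207738413810850,
  126593194418888546005985417107716837791860430018338009383540691681385460085023575196032540102096458795873333875553403194061666416246060855486829020246779252216809740,
  83207523855599988638497629420563814084762280183496462145274266175086019408827784958775730269682186288957351972902599080256149777750150493423843952845633397304516742,
  122855305165554071309275065178421486256421029898604607399196616246066730658660992089332879293365318482554813423495056493585863842503892503989266411408218374382691751,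
  52483224985400376600227403552543620026587691701366229289978271250136036271974127817517385270214184208821384742732085045628159093556109212286191738492396814661144385,
  66698400809817355738523242934539338784941616227682924818583977784413457208923077680460285628279691137839034963079325607020701296747257562069190231503027675498742316,
  894201078955070026813483104717312012592432552159383170478444641255160014455001062350315568001409769202188038425182712002916351993185581289373721460078909145302841,
  37024357314635234995764927365511657583464799470456533414049643406189293251257033335658830270297903089619763235193783856006383861401831671455202292997819371919460485,
  131721312189744107297460184142614094355466515364183014222906378047292022219246770413102501822470871507350913711228106949600507338726168302707585672883273999130579080,
  124346895762354571995047928120159570429156818492590903251907171312419820424632038212354682621931051145544678481679174055579606335867987489090608003283487536926264396,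
  98236246709410541242739915028610734334398597332936574484103939668618464118455719873530436831612482195489079695600545977036999526499540810632830594070873830593422007,
  133412846231879564312925198510522505008334359785734493366913208464553422506231954465906669120106824589003797241491733595553928017853056384810848630768615553663189296,
  6165918416154645966269115887616891290997461867991101687084785495480474553813572749266890512509310669824542665590962735345142000239459680925785156453887377517642528,
  121147702645006541909779888044955065333983231381479298297541904846634109825110673893490166829894514341597067047805111592956197200342708696662933052285643765098323252,
  63526408554663531770185261584650205180015753744844311532995245455594695235095206511119509923646115615835539743708666269262994773348119522612474977835813209652316989,
  72144233542874098073810333409987735831658326335886021977889262141708113426181469255755500893544588893407269022247422996033082825142871060239040327688567268928459138,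
  99695799712379167217947970335901890442553032028254754129069594038624889509281081877676998659481614978155375244393874935794496022603146847228056355018741081074048582,
  50662915988370263577698831977927429319274354158445517335766830856968250063575069975016798906296453495323075577088037120840961570895496249539547022416659843814381124,
  32888541435264839083336500908147605210760226251886079983734668634660664581802228647100047021660109691527313175650838264683138386504409101614758598875847195255299768,
  49235151363461027136317261048391349832891895046983596995598642815038856352068222284416974410051458711467578277816613292011528168793068920391898793847641948150800717,
  20810559010676112377300996254232614914375262228774404123140772872031580042916355800787695708848409762910020926424181418281671435987431629136156844247031887799111623,
  18777309694939749793859755057207830877705707440093791848967983956015607861387322074775002092072669536970968939211230658340779883362935510759573491487474477653905044,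
  114217061237182553015816998629008150509084235089021687434692075597708082887985322544136448252357284272793070005929873942620819442294580111656616124791175051392126510,
  17099630192157133073194911621504718015153548170455114014708617174076418913536040718395233137788966516492389891331872121777416892976444380189653043300233979749259152,
  44120054931346999169751166839641953295405504699905266896696923426544555434646273957300287046392002463366396518461161721888909206234236804901442047337067999677175817,
  87321603764956280176923566591325854516070922216248050422258236409576447430781118649685581658485606541515934880506685997449515886652576345401199164775619742864253504,
  70254461978325099873512405937099830510289358898454481337630664528242524913585668633531800124858763980718414009415996495379033184019611464605900796950572764611234987,
  96053957599100097140331047050753445239089411223925401186524144407981157165805537258606060867707871394691205888195131052006167146895452581463641911282822740706346922,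
  90209291024365123109431436133274969930027516840290551690066081019397869314895376847689002954634947110035484709809326066303259232403085431087297439745816156260361151,
  61566625107151731651735208950878425229214880846074628993119021517255404925935419995281725720708047257074230134027860364143516727874540530255908537995131755543437253,
  56830470392464169382494459254771023795973999530294498702882562097731701695629143370154272015392973472573912514590813140790914732177743449696336780995907783721178298,
  34747533451512398229447977714082477379874987521502037166311661067380716940467715130051968173487689823752725597607390880077562657767581887333660713635784942861551307,
  29159841653394816809084434858132976166541311503700149699274220803757852175202052363135612840843245192683545768145568287565678064851032890518661104374454557379404205,
  101865516907509067620608623389445295428124117589468934738964647900793056146156628704831005487805473031219398417199413697631535189198384384996995466138591675541720452,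
  41492045379641979664825998079694835313422400262932590669406329448162539349153691098507941948116551837106925282710105446580547462024188296506608192961962627591455771,
  2252207511800569420702239641129186100705514647804755279812806143856581187451814933062198054380073156225434339901595568986241644532912662145297600208612558639848869,
  106922919627925546083114973070960583730227987169542205305351923294540785104445503384936743481852522581030701843166923136142422398524589004273929287617377582940129818,
  108318381068055682982388878982262268039542000161561889626010645914379035258412389686314430487758498611567618697392715556335420689740893932873133224908946243435633809,
  13472503066685927987898956393233230458267098772014695561392338040772486418703018972303313442345801986098522099166172252681825386779364233338160621958392456626202152,
  135572790382899149400378210960708078349747701148782663041245626550546043754714218651261702332409259556719964318183072805055134242065038992347956000404917325027234447,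
  26017041700167692982504971977534231795767421294646692353306669209435279855350188928299142946370105807727186059096555271439824512955934459516596821749278081477198215,
  9026657463866670377695439043897306443459183271649692600190714552319044226617114734955047438696465720433498894736921014384821347753966291203825716614532153702257163,
  136856971770352932446302583299128425745983832925524022855634532366347319047800920725959670721376174450699159210782681313102589438052324580922364510038666583736935571,
  22115239262949667113905121079190593770074869147575261558554477860132941240287520912541061750006237812173735150502425853822009765176984478325717236605073818431297700,
  81111211563510152389066740032598648905562443922388988156503854647830553974311885842553968760332040255948853340422877554554620132780952334384217013848854294138642491,
  23834165964761375467186483155527457067765456186424898727307478152822309166603568768852590826146490481815859125356208989516223685826944131722966406776172320158816033,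
  130081033006346990240587515130903176963251202913307348454209881411200856197117643400271718619625787095236606742047520071441077967039094909122383298617242873173649034,
  74772207695628569860252943565556877421421632773142666702218596007826130380382858481607188482402368169909027352767879186086178813990271078853595075950315820715968958,
  3853667865640617760992212566291141092898866599136770493608563985883975701044538404453148521325860934834879842990623656046577065994122059575469176578055913654343069,
  110745262228648939773275493497890705975212483622341352691051625823323724706786826542422600545490173686697442340625561154725264170480829646404034531680983059136422694,
  119367211125984662352886586454610955858587965150810806680393610304540969337937290608287311925108017790813356538546529560749649785530642801563933038240389139543461910,
  78114735978955648157603692123320125830072591161439550779632159844445358469979628305447955978675553220240627417964881735510082702371485725443331876842117915579128205,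
  75726418210331401098858783203433778921042788038871702200973599143132553927454751739176446068744123923306231606997620547837700469474506136299963899065361760485821710,
  60053051924341776273532659008945824161500658267181319759543674520215169043126777895485321823053041140410120976791771587905206768238909828018656896949454606589744434,
  14677747445478747766168023759134560505367278003813138878669084381368457068284716861811636825275471207422289634816817317418747222540796856888176595649140495515081001,
  104391056318309159934869911099585520571127884908286308894938727330778121202500903499145112791504863240840842253902114682571402902018010279225368277245758886923599925,
  45551526406249176923133810020727498482694082458952061350495568449539384570197137680806577687002891901939648878040821728589624475030615993763296641836420488546456393,
  93580634415850130303304088489509889601188659109862056164192710560751669794798069588905397571826409231410255312836510702356872707279765642357631063252028149661115651,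
  864001901717285646318139909736957108936745784616789731203774266631962543633602497493798988014059310389054353624608364204073803974845320095045074357761189925149465]

theorem existsTripleSystem_77 : ExistsTripleSystem 77 :=
  existsTripleSystem_of_rows tripleRows78 (by norm_num) (by decide +kernel) (by decide +kernel)

/-! ### Exchange of finitely many triples, and its effect on links. -/

/-- A ternary operation that behaves like a triple system except on pairs of points that both
satisfy `P`. -/
structure IsPartialTripleSystem {W : Type*} (P : W → Prop) (T : W → W → W) : Prop where
  ne_left : ∀ x y, x ≠ y → ¬ (P x ∧ P y) → T x y ≠ x
  ne_right : ∀ x y, x ≠ y → ¬ (P x ∧ P y) → T x y ≠ y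
  rotate : ∀ x y, x ≠ y → ¬ (P x ∧ P y) → T y (T x y) = x
  not_of_right : ∀ x y, x ≠ y → ¬ (P x ∧ P y) → P y → ¬ P (T x y)

/-- A finite exchange of triples: the triples `old` of the operation `T` are to be replaced by the
triples `new`, which cover in addition all pairs of points with `P`. Both are given as partial
operations on an index type `J`. -/
structure Exchange {W : Type*} (P : W → Prop) (T : W → W → W) (J : Type*) where
  pt : J → W
  inj : Function.Injective pt
  old : J → J → Option J
  new : J → J → Option J
  new_rotate : ∀ a b c, new a b = some c → new b c = some a
  new_ne : ∀ a b c, new a b = some c → a ≠ b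
  old_rotate : ∀ a b c, old a b = some c → old b c = some a
  old_eq : ∀ a b c, old a b = some c → T (pt a) (pt b) = pt c
  new_of_old : ∀ a b, (old a b).isSome → (new a b).isSome
  old_of_new : ∀ a b, (new a b).isSome → (old a b).isSome ∨ P (pt a) ∧ P (pt b)
  new_of_letters : ∀ x y, x ≠ y → P x → P y → ∃ a b, pt a = x ∧ pt b = y ∧ (new a b).isSome

namespace Exchange

variable {W J : Type*} {P : W → Prop} {T : W → W → W} (E : Exchange P T J)

/-- The pairs on which the operation is changed. -/
def Key (x y : W) : Prop := ∃ a b c, E.pt a = x ∧ E.pt b = y ∧ E.new a b = some c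

open Classical in
/-- The operation after the exchange. -/
noncomputable def op (x y : W) : W :=
  if h : ∃ z, ∃ a b c, E.pt a = x ∧ E.pt b = y ∧ E.new a b = some c ∧ E.pt c = z then h.choose
  else T x y

theorem op_pt {a b c : J} (h : E.new a b = some c) : E.op (E.pt a) (E.pt b) = E.pt c := by
  have hk : ∃ z, ∃ a' b' c', E.pt a' = E.pt a ∧ E.pt b' = E.pt b ∧ E.new a' b' = some c' ∧
    E.pt c' = z := ⟨_, a, b, c, rfl, rfl, h, rfl⟩
  rw [op, dif_pos hk]
  obtain ⟨a', b', c', h1, h2, h3, h4⟩ := hk.choose_spec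
  rw [E.inj h1, E.inj h2, h] at h3
  rw [← h4, Option.some.inj h3]

theorem op_of_not_key {x y : W} (h : ¬ E.Key x y) : E.op x y = T x y := by
  rw [op, dif_neg]
  rintro ⟨_, a, b, c, ha, hb, hc, -⟩
  exact h ⟨a, b, c, ha, hb, hc⟩

theorem key_of_old {a b c : J} (h : E.old a b = some c) : E.Key (E.pt a) (E.pt b) := by
  have := E.new_of_old a b (by rw [h]; rfl)
  obtain ⟨d, hd⟩ := Option.isSome_iff_exists.1 this
  exact ⟨a, b, d, rfl, rfl, hd⟩

theorem not_letters_of_not_key {x y : W} (hxy : x ≠ y) (h : ¬ E.Key x y) : ¬ (P x ∧ P y) :=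
  fun ⟨hx, hy⟩ => by
    obtain ⟨a, b, ha, hb, hab⟩ := E.new_of_letters x y hxy hx hy
    obtain ⟨d, hd⟩ := Option.isSome_iff_exists.1 hab
    exact h ⟨a, b, d, ha, hb, hd⟩

/-- The pairs covered by the new triples are those of the old ones together with pairs of points
with `P`, so the unchanged triples and the new triples do not overlap and cover everything. -/
theorem isTripleSystem_op (hT : IsPartialTripleSystem P T) : IsTripleSystem E.op where
  ne_left x y hxy := by
    by_cases hk : E.Key x y
    · obtain ⟨a, b, c, rfl, rfl, h⟩ := hk
      rw [E.op_pt h]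
      exact E.inj.ne (E.new_ne c a b (E.new_rotate _ _ _ (E.new_rotate _ _ _ h)))
    · rw [E.op_of_not_key hk]
      exact hT.ne_left x y hxy (E.not_letters_of_not_key hxy hk)
  ne_right x y hxy := by
    by_cases hk : E.Key x y
    · obtain ⟨a, b, c, rfl, rfl, h⟩ := hk
      rw [E.op_pt h]
      exact E.inj.ne (E.new_ne b c a (E.new_rotate _ _ _ h)).symm
    · rw [E.op_of_not_key hk]
      exact hT.ne_right x y hxy (E.not_letters_of_not_key hxy hk)
  rotate x y hxy := by
    by_cases hk : E.Key x y
    · obtain ⟨a, b, c, rfl, rfl, h⟩ := hk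
      rw [E.op_pt h, E.op_pt (E.new_rotate _ _ _ h)]
    · have hl := E.not_letters_of_not_key hxy hk
      rw [E.op_of_not_key hk]
      -- An unchanged triple has no changed pair: an old pair would drag its whole triple along, and
      -- no triple defined by `T` contains two points with `P`.
      have hk' : ¬ E.Key y (T x y) := by
        rintro ⟨b, c, a, hb, hc, h⟩
        rcases E.old_of_new b c (by rw [h]; rfl) with h1 | ⟨h1, h2⟩
        · obtain ⟨a', ha'⟩ := Option.isSome_iff_exists.1 h1
          have h2 := E.old_eq _ _ _ ha'
          rw [hb, hc, hT.rotate x y hxy hl] at h2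
          apply hk
          rw [h2, ← hb]
          exact E.key_of_old (E.old_rotate _ _ _ (E.old_rotate _ _ _ ha'))
        · rw [hb] at h1
          rw [hc] at h2
          exact hT.not_of_right x y hxy hl h1 h2
      rw [E.op_of_not_key hk', hT.rotate x y hxy hl]

/-- The link of a point that is not involved in the exchange. -/
theorem linkConnected_of_forall_ne {v : W} (hv : ∀ a, E.pt a ≠ v) (h : LinkConnected T v) :
    LinkConnected E.op v := by
  intro r hr
  refine h r fun a ha => ?_
  rw [← E.op_of_not_key (x := a) (y := v)]
  · exact hr a ha
  · rintro ⟨_, b, _, _, hb, _⟩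
    exact hv b hb

/-- Whether `c` is reached from `b` by at most `n` exchanged steps in the link of `k`. -/
def reach [DecidableEq J] (new : J → J → Option J) (k : J) : ℕ → J → J → Bool
  | 0, b, c => b == c
  | n + 1, b, c => b == c || match new b k with
    | some d => reach new k n d c
    | none => false

/-- The retraction of the removed points of the link of `k` along `old` steps. -/
def retract (old : J → J → Option J) (k : J) : ℕ → J → J
  | 0, b => b
  | n + 1, b => if (old b k).isSome then match old k b with
    | some a => retract old k n a
    | none => b
    else b

theorem reach_sound [DecidableEq J] {k : J} {r : Setoid W} (hr : ∀ a, a ≠ E.pt k → r a (E.op a (E.pt k))) (n : ℕ)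
    {b c : J} (h : reach E.new k n b c = true) : r (E.pt b) (E.pt c) := by
  induction n generalizing b with
  | zero => rw [beq_iff_eq.1 h]
  | succ n ih =>
    rw [reach, Bool.or_eq_true] at h
    rcases h with h | h
    · rw [beq_iff_eq.1 h]
    · split at h
      · rename_i d hd
        have h1 := hr (E.pt b) (E.inj.ne (E.new_ne _ _ _ hd))
        rw [E.op_pt hd] at h1
        exact r.trans h1 (ih h)
      · cases h

/-- Only points that lose both their outgoing and their incoming link step are moved. Such points
may be reinserted elsewhere in the new link, so new steps need not join them to their former
neighbours; the retraction passes them over. -/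
theorem retract_ne {k : J} {n : ℕ} {b : J} (h : retract E.old k n b ≠ b) :
    (E.old b k).isSome ∧ (E.old k b).isSome := by
  cases n with
  | zero => exact absurd rfl h
  | succ n =>
    rw [retract] at h
    split_ifs at h with h1
    · refine ⟨h1, ?_⟩
      split at h
      · rename_i a ha
        rw [ha]; rfl
      · exact absurd rfl h
    · exact absurd rfl h

/-- The link of a point that is involved in the exchange: it suffices to check finitely many
exchanged steps, by reachability within `n` steps. -/
theorem linkConnected_pt [DecidableEq J] (hT : IsPartialTripleSystem P T) {k : J} (n : ℕ)
    (hbase : ∀ r : Setoid W, (∀ a, a ≠ E.pt k → ¬ (P a ∧ P (E.pt k)) → r a (T a (E.pt k))) →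
      ∀ x y, x ≠ E.pt k → y ≠ E.pt k → ¬ (P x ∧ P (E.pt k)) → ¬ (P y ∧ P (E.pt k)) → r x y)
    (hold : ∀ b c, E.old b k = some c →
      (reach E.new k n (retract E.old k n b) (retract E.old k n c) ||
        reach E.new k n (retract E.old k n c) (retract E.old k n b)) = true)
    (hfix : ∀ b, b ≠ k → ∃ b', b' ≠ k ∧ ¬ (P (E.pt b') ∧ P (E.pt k)) ∧
      retract E.old k n b' = b' ∧ (reach E.new k n b b' || reach E.new k n b' b) = true) :
    LinkConnected E.op (E.pt k) := by
  classical
  intro r hr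
  have hrel : ∀ b c, (reach E.new k n b c || reach E.new k n c b) = true →
      r (E.pt b) (E.pt c) := fun b c h => by
    rw [Bool.or_eq_true] at h
    rcases h with h | h
    · exact E.reach_sound hr n h
    · exact r.symm (E.reach_sound hr n h)
  let ρ : W → W := fun x => if h : ∃ b, E.pt b = x then E.pt (retract E.old k n h.choose) else x
  have hρ : ∀ b, ρ (E.pt b) = E.pt (retract E.old k n b) := fun b => by
    have hb : ∃ b', E.pt b' = E.pt b := ⟨b, rfl⟩
    simp only [ρ, dif_pos hb]
    rw [E.inj hb.choose_spec]
  have hρ_self : ∀ x, (∀ b, E.pt b = x → retract E.old k n b = b) → ρ x = x := fun x h => by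
    by_cases hx : ∃ b, E.pt b = x
    · obtain ⟨b, rfl⟩ := hx
      rw [hρ, h b rfl]
    · simp only [ρ, dif_neg hx]
  -- The old link is connected, so it suffices that `ρ` carries each of its steps into `r`. Removed
  -- steps are covered by `hold`; a kept step has both its ends fixed by `ρ` and is still a step of
  -- the new link.
  have hall := hbase (r.comap ρ) fun a ha hl => by
    rw [Setoid.comap_rel]
    by_cases hk : E.Key a (E.pt k)
    · obtain ⟨b, k', c, rfl, hk', h⟩ := hk
      obtain rfl := E.inj hk'
      rcases E.old_of_new b k' (by rw [h]; rfl) with h1 | h1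
      · obtain ⟨d, hd⟩ := Option.isSome_iff_exists.1 h1
        rw [E.old_eq _ _ _ hd, hρ, hρ]
        exact hrel _ _ (hold b d hd)
      · exact absurd h1 hl
    · have h1 : ρ a = a := hρ_self a fun b hb => by
        by_contra hne
        obtain ⟨d, hd⟩ := Option.isSome_iff_exists.1 (E.retract_ne hne).1
        exact hk (hb ▸ E.key_of_old hd)
      have h2 : ρ (T a (E.pt k)) = T a (E.pt k) := hρ_self _ fun b hb => by
        by_contra hne
        obtain ⟨d, hd⟩ := Option.isSome_iff_exists.1 (E.retract_ne hne).2
        have h3 := E.old_eq _ _ _ hd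
        rw [hb, hT.rotate a _ ha hl] at h3
        rw [h3] at hk
        exact hk (E.key_of_old (E.old_rotate _ _ _ (E.old_rotate _ _ _ hd)))
      rw [h1, h2, ← E.op_of_not_key hk]
      exact hr a ha
  -- Every point, including those with `P` that are missing from the old link, is joined to the
  -- image of a point of the old link.
  have hret : ∀ x, x ≠ E.pt k → ∃ y, y ≠ E.pt k ∧ ¬ (P y ∧ P (E.pt k)) ∧ r x (ρ y) := by
    intro x hx
    by_cases hx' : ∃ b, E.pt b = x
    · obtain ⟨b, rfl⟩ := hx'
      obtain ⟨b', h1, h2, h3, h4⟩ := hfix b (fun h => hx (by rw [h]))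
      refine ⟨E.pt b', E.inj.ne h1, h2, ?_⟩
      rw [hρ, h3]
      exact hrel _ _ h4
    · refine ⟨x, hx, fun h => ?_, ?_⟩
      · obtain ⟨a, b, ha, -⟩ := E.new_of_letters x _ hx h.1 h.2
        exact hx' ⟨a, ha⟩
      · rw [hρ_self x fun b hb => absurd ⟨b, hb⟩ hx']
  intro x y hx hy
  obtain ⟨x', hx1, hx2, hx3⟩ := hret x hx
  obtain ⟨y', hy1, hy2, hy3⟩ := hret y hy
  exact r.trans hx3 (r.trans (hall x' y' hx1 hy1 hx2 hy2) (r.symm hy3))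

end Exchange

/-! ### Current graphs and their derived triples. -/

/-- An index one current graph with cubic vertices `ι` and vortices `κ`: the currents on the darts
are the nonzero elements of `G`, each exactly once, and the currents at each cubic vertex satisfy
Kirchhoff's law. -/
structure CurrentGraph (G : Type*) [AddCommGroup G] (ι κ : Type*) where
  tri : ι → Fin 3 → G
  cur : κ → G
  inj : Function.Injective (Sum.elim (fun d : ι × Fin 3 => tri d.1 d.2) cur)
  tri_ne : ∀ t i, tri t i ≠ 0
  cur_ne : ∀ k, cur k ≠ 0
  surj : ∀ x, x ≠ 0 → (∃ t i, tri t i = x) ∨ ∃ k, cur k = x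
  sum_eq : ∀ t, tri t 0 + tri t 1 + tri t 2 = 0

namespace CurrentGraph

variable {G ι κ : Type*} [AddCommGroup G] (C : CurrentGraph G ι κ)

/-- Translation of the points other than the vortices. -/
def shift (v : G) : G ⊕ κ → G ⊕ κ := Sum.map (v + ·) id

theorem sum_eq' (t : ι) (i : Fin 3) : C.tri t i + C.tri t (i + 1) + C.tri t (i + 2) = 0 := by
  have h := C.sum_eq t
  fin_cases i
  · exact h
  · change C.tri t 1 + C.tri t 2 + C.tri t 0 = 0
    rw [← h]; abel
  · change C.tri t 2 + C.tri t 0 + C.tri t 1 = 0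
    rw [← h]; abel

open Classical in
/-- The point that follows a nonzero current. -/
noncomputable def succ (x : G) : G ⊕ κ :=
  if h : ∃ d : ι × Fin 3, C.tri d.1 d.2 = x then Sum.inl (C.tri h.choose.1 (h.choose.2 + 1))
  else if h : ∃ k, C.cur k = x then Sum.inr h.choose else Sum.inl 0

theorem succ_tri (t : ι) (i : Fin 3) : C.succ (C.tri t i) = Sum.inl (C.tri t (i + 1)) := by
  have h : ∃ d : ι × Fin 3, C.tri d.1 d.2 = C.tri t i := ⟨(t, i), rfl⟩
  rw [succ, dif_pos h]
  have h2 : Sum.inl h.choose = (Sum.inl (t, i) : (ι × Fin 3) ⊕ κ) := C.inj h.choose_spec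
  rw [Sum.inl.inj h2]

theorem succ_cur (k : κ) : C.succ (C.cur k) = Sum.inr k := by
  have h : ¬ ∃ d : ι × Fin 3, C.tri d.1 d.2 = C.cur k := fun ⟨d, hd⟩ => by
    have h2 : Sum.inl d = (Sum.inr k : (ι × Fin 3) ⊕ κ) := C.inj hd
    cases h2
  have h' : ∃ k', C.cur k' = C.cur k := ⟨k, rfl⟩
  rw [succ, dif_neg h, dif_pos h']
  have h2 : Sum.inr h'.choose = (Sum.inr k : (ι × Fin 3) ⊕ κ) := C.inj h'.choose_spec
  rw [Sum.inr.inj h2]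

/-- The oriented triples of the derived embedding. -/
noncomputable def third : G ⊕ κ → G ⊕ κ → G ⊕ κ
  | Sum.inl u, Sum.inl v => shift v (C.succ (v - u))
  | Sum.inr k, Sum.inl v => Sum.inl (v + C.cur k)
  | Sum.inl u, Sum.inr k => Sum.inl (u - C.cur k)
  | Sum.inr k, Sum.inr _ => Sum.inr k

theorem third_of_tri {u v : G} {t : ι} {i : Fin 3} (h : v - u = C.tri t i) :
    C.third (Sum.inl u) (Sum.inl v) = Sum.inl (v + C.tri t (i + 1)) := by
  rw [third, h, succ_tri]
  rfl

theorem third_of_cur {u v : G} {k : κ} (h : v - u = C.cur k) :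
    C.third (Sum.inl u) (Sum.inl v) = Sum.inr k := by
  rw [third, h, succ_cur]
  rfl

/-- Consecutive differences around a derived triple of group elements are the three currents at a
cubic vertex, and Kirchhoff's law closes the triple up. The other triples are `(u, u + cur k, k)`
for a vortex `k`. -/
theorem isPartialTripleSystem :
    IsPartialTripleSystem (fun x : G ⊕ κ => x.isRight = true) C.third := by
  have key : ∀ x y, x ≠ y → ¬ (x.isRight = true ∧ y.isRight = true) →
      C.third x y ≠ x ∧ C.third x y ≠ y ∧ C.third y (C.third x y) = x ∧
        (y.isRight = true → ¬ (C.third x y).isRight = true) := by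
    intro x y hxy hP
    rcases x with u | k <;> rcases y with v | l
    · have huv : v - u ≠ 0 := fun h => hxy (by rw [sub_eq_zero.1 h])
      rcases C.surj _ huv with ⟨t, i, h⟩ | ⟨k, h⟩
      · have h3 := C.sum_eq' t i
        rw [C.third_of_tri h.symm]
        have h1 : C.tri t (i + 1) = v + C.tri t (i + 1) - v := by abel
        have h4 : v + C.tri t (i + 1) + C.tri t (i + 2) = u := by
          have : C.tri t (i + 2) = -(C.tri t i) - C.tri t (i + 1) := by
            rw [← sub_eq_zero, ← h3]; abel
          rw [this, h]; abel
        refine ⟨?_, ?_, ?_, ?_⟩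
        · intro h5
          rw [Sum.inl.inj h5] at h4
          exact C.tri_ne t (i + 2) (by simpa using h4)
        · intro h5
          exact C.tri_ne t (i + 1) (by simpa using Sum.inl.inj h5)
        · rw [C.third_of_tri (t := t) (i := i + 1) h1.symm, add_assoc i, show (1 : Fin 3) + 1 = 2 from rfl, h4]
        · simp
      · rw [C.third_of_cur h.symm]
        refine ⟨by simp, by simp, ?_, by simp⟩
        rw [third, h]
        simp
    · refine ⟨?_, by simp [third], ?_, ?_⟩
      · intro h
        exact C.cur_ne l (by simpa [third] using h)
      · simp [third]
      · simp [third]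
    · refine ⟨by simp [third], ?_, ?_, ?_⟩
      · intro h
        exact C.cur_ne k (by simpa [third] using h)
      · rw [third, C.third_of_cur (k := k)]
        abel
      · simp
    · exact absurd ⟨rfl, rfl⟩ hP
  exact ⟨fun x y h h' => (key x y h h').1, fun x y h h' => (key x y h h').2.1,
    fun x y h h' => (key x y h h').2.2.1, fun x y h h' => (key x y h h').2.2.2⟩

/-- The rotation at the base point has a single orbit. -/
def Connected : Prop :=
  ∀ q : Setoid G, (∀ t i, q (-C.tri t i) (C.tri t (i + 1))) → (∀ k, q (-C.cur k) (C.cur k)) →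
    ∀ x y, x ≠ 0 → y ≠ 0 → q x y

variable {C}

/-- By translation the link of `v` is the rotation at the base point shifted by `v`, with the vortex
`k` inserted between `-cur k` and `cur k`. -/
theorem Connected.link (hC : C.Connected) (v : G) : LinkConnected C.third (Sum.inl v) := by
  intro r hr
  let q : Setoid G := r.comap fun x => Sum.inl (v + x)
  have hq : ∀ x y, x ≠ 0 → y ≠ 0 → q x y := by
    apply hC
    · intro t i
      have h := hr (Sum.inl (v + -C.tri t i)) (by simp [C.tri_ne])
      rwa [C.third_of_tri (t := t) (i := i) (by abel)] at h
    · intro k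
      have h := hr (Sum.inl (v + -C.cur k)) (by simp [C.cur_ne])
      rw [C.third_of_cur (k := k) (by abel)] at h
      exact r.trans h (hr (Sum.inr k) (by simp))
  have hx : ∀ x, x ≠ Sum.inl v → ∃ y, y ≠ 0 ∧ r x (Sum.inl (v + y)) := by
    rintro (x | k) hx
    · refine ⟨x - v, fun h => hx (by rw [sub_eq_zero.1 h]), ?_⟩
      rw [add_sub_cancel]
    · exact ⟨C.cur k, C.cur_ne k, hr (Sum.inr k) (by simp)⟩
  intro x y hxv hyv
  obtain ⟨x', hx0, hx'⟩ := hx x hxv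
  obtain ⟨y', hy0, hy'⟩ := hx y hyv
  exact r.trans hx' (r.trans (hq x' y' hx0 hy0) (r.symm hy'))

end CurrentGraph

/-! ### Comparing affine families uniformly in `s`. -/

/-- The integers `a + b * s + step * j` for `0 ≤ j ≤ s - 7 - gap`, for a parameter `s ≥ 7`. -/
structure AffineFamily where
  a : ℤ
  b : ℤ
  step : ℤ
  gap : ℤ

namespace AffineFamily

/-- A member of a family. -/
def val (f : AffineFamily) (s j : ℤ) : ℤ := f.a + f.b * s + f.step * j

/-- Admissible parameters. -/
def Adm (f : AffineFamily) (s j : ℤ) : Prop := 7 ≤ s ∧ 0 ≤ j ∧ j ≤ s - 7 - f.gap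

/-- All members of `f` are smaller than those of `h`, by comparison of linear bounds. -/
def below (f h : AffineFamily) : Bool :=
  let s₀ := 7 + max f.gap h.gap
  f.a - max f.step 0 * (7 + f.gap) + (f.b + max f.step 0) * s₀ <
    h.a - min h.step 0 * (7 + h.gap) + (h.b + min h.step 0) * s₀ &&
  f.b + max f.step 0 ≤ h.b + min h.step 0

/-- The members of `f` and `h` are different modulo `d`. -/
def differMod (d : ℤ) (f h : AffineFamily) : Bool :=
  (f.a - h.a) % d != 0 && (f.b - h.b) % d == 0 && f.step % d == 0 && h.step % d == 0

/-- The families `f` and `h` have no common member. -/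
def sep (f h : AffineFamily) : Bool :=
  differMod 3 f h || below f h || below h f || differMod 6 f h

theorem val_lt_of_below {f h : AffineFamily} (hb : below f h = true) {s j j' : ℤ}
    (hf : f.Adm s j) (hh : h.Adm s j') : f.val s j < h.val s j' := by
  obtain ⟨hs, hj, hj2⟩ := hf
  obtain ⟨-, hj', hj2'⟩ := hh
  simp only [below, Bool.and_eq_true, decide_eq_true_eq] at hb
  obtain ⟨h1, h2⟩ := hb
  unfold val
  set p := max f.step 0
  set r := min h.step 0
  have hp : f.step * j ≤ p * (s - 7 - f.gap) :=
    (mul_le_mul_of_nonneg_right (le_max_left _ _) hj).trans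
      (mul_le_mul_of_nonneg_left hj2 (le_max_right _ _))
  have hr : r * (s - 7 - h.gap) ≤ h.step * j' :=
    (mul_le_mul_of_nonpos_left hj2' (min_le_right _ _)).trans
      (mul_le_mul_of_nonneg_right (min_le_left _ _) hj')
  -- Both families have an admissible index, so `s` is at least the value at which `below` compares
  -- the bounds; beyond it the slopes decide.
  have hs0 : 0 ≤ s - (7 + max f.gap h.gap) := by
    rcases max_cases f.gap h.gap with ⟨h, -⟩ | ⟨h, -⟩ <;> rw [h] <;> linarith
  have := mul_nonneg hs0 (sub_nonneg.2 h2)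
  nlinarith

theorem val_ne_of_differMod {d : ℤ} {f h : AffineFamily} (hd : differMod d f h = true)
    (s j j' : ℤ) : f.val s j ≠ h.val s j' := by
  simp only [differMod, Bool.and_eq_true, bne_iff_ne, beq_iff_eq, ne_eq] at hd
  obtain ⟨⟨⟨h1, h2⟩, h3⟩, h4⟩ := hd
  intro heq
  apply h1
  apply Int.emod_eq_zero_of_dvd
  have : f.a - h.a = h.step * j' - f.step * j - (f.b - h.b) * s := by
    unfold val at heq
    linarith
  rw [this]
  exact dvd_sub (dvd_sub ((Int.dvd_of_emod_eq_zero h4).mul_right _)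
    ((Int.dvd_of_emod_eq_zero h3).mul_right _)) ((Int.dvd_of_emod_eq_zero h2).mul_right _)

theorem val_ne_of_sep {f h : AffineFamily} (hs : sep f h = true) {s j j' : ℤ}
    (hf : f.Adm s j) (hh : h.Adm s j') : f.val s j ≠ h.val s j' := by
  simp only [sep, Bool.or_eq_true] at hs
  rcases hs with ((hs | hs) | hs) | hs
  · exact val_ne_of_differMod hs _ _ _
  · exact (val_lt_of_below hs hf hh).ne
  · exact (val_lt_of_below hs hh hf).ne'
  · exact val_ne_of_differMod hs _ _ _

/-- The constant family `a + b * s`. -/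
def const (p : ℤ × ℤ) : AffineFamily := ⟨p.1, p.2, 0, 0⟩

/-- The members of `f` lie in the interval `(-6 s - 1, 6 s + 2)`. -/
def inRange (f : AffineFamily) : Bool := below (const (-1, -6)) f && below f (const (2, 6))

theorem const_adm {p : ℤ × ℤ} {s : ℤ} (hs : 7 ≤ s) : (const p).Adm s 0 :=
  ⟨hs, le_rfl, by simp only [const]; linarith⟩

theorem bounds_of_inRange {f : AffineFamily} (h : inRange f = true) {s j : ℤ} (hf : f.Adm s j) :
    -6 * s ≤ f.val s j ∧ f.val s j ≤ 6 * s + 1 := by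
  simp only [inRange, Bool.and_eq_true] at h
  have h1 := val_lt_of_below h.1 (const_adm hf.1) hf
  have h2 := val_lt_of_below h.2 hf (const_adm hf.1)
  simp only [const, val] at h1 h2 ⊢
  constructor <;> linarith

/-- The range `-6 s, …, 6 s + 1` is a complete residue system modulo `12 s + 2`, so residues can be
compared as integers. -/
theorem val_eq_of_cast_eq {f h : AffineFamily} (hf' : inRange f = true)
    (hh' : inRange h = true) {s : ℕ} {j j' : ℤ} (hf : f.Adm s j) (hh : h.Adm s j')
    (heq : ((f.val s j : ℤ) : ZMod (12 * s + 2)) = ((h.val s j' : ℤ) : ZMod (12 * s + 2))) :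
    f.val s j = h.val s j' := by
  have h1 := bounds_of_inRange hf' hf
  have h2 := bounds_of_inRange hh' hh
  rw [ZMod.intCast_eq_intCast_iff_dvd_sub] at heq
  refine (sub_eq_zero.1 (Int.eq_zero_of_abs_lt_dvd heq ?_)).symm
  push_cast
  rw [abs_lt]
  constructor <;> linarith

theorem cast_ne_of_sep {f h : AffineFamily} (hs : sep f h = true) (hf' : inRange f = true)
    (hh' : inRange h = true) {s : ℕ} {j j' : ℤ} (hf : f.Adm s j) (hh : h.Adm s j') :
    ((f.val s j : ℤ) : ZMod (12 * s + 2)) ≠ ((h.val s j' : ℤ) : ZMod (12 * s + 2)) :=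
  fun heq => val_ne_of_sep hs hf hh (val_eq_of_cast_eq hf' hh' hf hh heq)

end AffineFamily

/-! ### The current graph over `ZMod (12 s + 2)` for `s ≥ 7`. -/

namespace GenericPrism

/-- The coefficients `(a, b, step)` of the currents at the cubic vertices; the last four rows
stand for the rungs of two ladders. -/
def coeff : Fin 29 → Fin 3 → ℤ × ℤ × ℤ := ![
  ![(2, 0, 0), (8, -6, 0), (-10, 6, 0)],
  ![(4, 0, 0), (-9, 6, 0), (5, -6, 0)],
  ![(5, 0, 0), (-12, 0, 0), (7, 0, 0)],
  ![(9, 0, 0), (-6, 0, 0), (-3, 0, 0)],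
  ![(12, 0, 0), (-4, 0, 0), (-8, 0, 0)],
  ![(18, 0, 0), (0, -6, 0), (-18, 6, 0)],
  ![(-2, 6, 0), (-2, 0, 0), (4, -6, 0)],
  ![(-1, 6, 0), (2, -6, 0), (-1, 0, 0)],
  ![(7, -6, 0), (-18, 0, 0), (9, -6, 0)],
  ![(18, -6, 0), (-7, 3, 0), (-11, 3, 0)],
  ![(15, -6, 0), (-15, 0, 0), (0, 6, 0)],
  ![(11, -6, 0), (-5, -3, 0), (-8, -3, 0)],
  ![(15, 0, 0), (-8, 3, 0), (-7, -3, 0)],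
  ![(6, -6, 0), (-5, 3, 0), (-1, 3, 0)],
  ![(12, -6, 0), (-5, 0, 0), (-7, 6, 0)],
  ![(8, 0, 0), (-11, 6, 0), (3, -6, 0)],
  ![(-4, 3, 0), (1, 6, 0), (5, 3, 0)],
  ![(3, 0, 0), (-1, -3, 0), (-2, 3, 0)],
  ![(1, 3, 0), (4, 3, 0), (-3, 6, 0)],
  ![(2, 3, 0), (8, 3, 0), (-8, 6, 0)],
  ![(-4, 6, 0), (-4, -3, 0), (8, -3, 0)],
  ![(-2, -3, 0), (7, -3, 0), (-5, 6, 0)],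
  ![(-15, 6, 0), (5, -3, 0), (10, -3, 0)],
  ![(-12, 6, 0), (11, -3, 0), (1, -3, 0)],
  ![(-6, 6, 0), (4, -3, 0), (2, -3, 0)],
  ![(-10, 3, -3), (-11, -3, -3), (21, 0, 6)],
  ![(7, 3, 3), (14, -3, 3), (-21, 0, -6)],
  ![(11, 3, 3), (13, -3, 3), (-24, 0, -6)],
  ![(-14, 3, -3), (-10, -3, -3), (24, 0, 6)]]

/-- The currents of the four vortices. -/
def vortex : Fin 4 → ℤ × ℤ := ![(1, 0), (1, -6), (-9, 0), (6, 0)]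

/-- The family of currents on the `i`-th dart of the cubic vertices of type `t`. -/
def family (t : Fin 29) (i : Fin 3) : AffineFamily :=
  ⟨(coeff t i).1, (coeff t i).2.1, (coeff t i).2.2, if t < 27 then 0 else 1⟩

/-- One finite check for all `s` and all ladder indices. Residues modulo 3 and linear bounds
separate most families; the interleaved progressions `21 + 6 j` and `24 + 6 j` need the modulus 6.
-/
theorem sep_family : ∀ t i t' i', (t, i) ≠ (t', i') → (family t i).sep (family t' i') = true := by
  decide +kernel

theorem sep_family_vortex : ∀ t i k, (family t i).sep (.const (vortex k)) = true := by
  decide +kernel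

theorem sep_family_zero : ∀ t i, (family t i).sep (.const 0) = true := by
  decide +kernel

theorem sep_vortex_zero : ∀ k, (AffineFamily.const (vortex k)).sep (.const 0) = true := by
  decide +kernel

theorem sep_vortex : ∀ k l, k ≠ l →
    (AffineFamily.const (vortex k)).sep (.const (vortex l)) = true := by
  decide +kernel

theorem inRange_family : ∀ t i, (family t i).inRange = true := by
  decide +kernel

theorem inRange_vortex : ∀ k, (AffineFamily.const (vortex k)).inRange = true := by
  decide +kernel

theorem step_ne_zero : ∀ t, 25 ≤ t → ∀ i, (family t i).step ≠ 0 := by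
  decide +kernel

/-- Kirchhoff's law with indeterminate `s`: the sum is 0 or plus or minus the modulus `12 s + 2`,
and the ladder steps cancel. -/
theorem sum_coeff : ∀ t, (coeff t 0).2.2 + (coeff t 1).2.2 + (coeff t 2).2.2 = 0 ∧
    ∃ k : Fin 3, (coeff t 0).1 + (coeff t 1).1 + (coeff t 2).1 = 2 * ((k : ℤ) - 1) ∧
      (coeff t 0).2.1 + (coeff t 1).2.1 + (coeff t 2).2.1 = 12 * ((k : ℤ) - 1) := by
  decide +kernel

/-- The number of cubic vertices of a type. -/
def count (s : ℕ) (t : Fin 29) : ℕ := if t < 25 then 1 else if t < 27 then s - 6 else s - 7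

/-- The cubic vertices. -/
abbrev Cubic (s : ℕ) : Type := (t : Fin 29) × Fin (count s t)

/-- The current `a + b * s`. -/
def lab (s : ℕ) (p : ℤ × ℤ) : ZMod (12 * s + 2) := ((p.1 + p.2 * s : ℤ) : ZMod (12 * s + 2))

/-- The currents at the cubic vertices. -/
def current (s : ℕ) (t : Cubic s) (i : Fin 3) : ZMod (12 * s + 2) :=
  (((family t.1 i).val s (t.2 : ℕ) : ℤ) : ZMod (12 * s + 2))

theorem lab_eq (s : ℕ) (p : ℤ × ℤ) :
    lab s p = (((AffineFamily.const p).val s 0 : ℤ) : ZMod (12 * s + 2)) := by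
  simp [lab, AffineFamily.const, AffineFamily.val]

theorem cast_modulus (s : ℕ) : (((12 * s + 2 : ℤ)) : ZMod (12 * s + 2)) = 0 := by
  have := ZMod.natCast_self (12 * s + 2)
  exact_mod_cast this

variable {s : ℕ}

theorem adm (hs : 7 ≤ s) (t : Cubic s) (i : Fin 3) : (family t.1 i).Adm s (t.2 : ℕ) := by
  obtain ⟨t, j, hj⟩ := t
  unfold count at hj
  refine ⟨by exact_mod_cast hs, by positivity, ?_⟩
  simp only [family]
  split_ifs at hj ⊢ with h1 h2
  all_goals omega

theorem card_cubic (hs : 7 ≤ s) : Fintype.card (Cubic s) = 4 * s - 1 := by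
  rw [Fintype.card_sigma]
  simp only [Fintype.card_fin]
  simp only [count, Finset.sum_ite, Finset.sum_const, smul_eq_mul, Finset.filter_filter]
  have h1 : (Finset.univ.filter fun t : Fin 29 => t < 25).card = 25 := by decide
  have h2 : (Finset.univ.filter fun t : Fin 29 => ¬ t < 25 ∧ t < 27).card = 2 := by decide
  have h3 : (Finset.univ.filter fun t : Fin 29 => ¬ t < 25 ∧ ¬ t < 27).card = 2 := by decide
  rw [h1, h2, h3]
  omega

theorem current_injective (hs : 7 ≤ s) : Function.Injective
    (Sum.elim (fun d : Cubic s × Fin 3 => current s d.1 d.2) (fun k => lab s (vortex k))) := by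
  have hs' : (7 : ℤ) ≤ s := by exact_mod_cast hs
  have hfv : ∀ (d : Cubic s × Fin 3) k, current s d.1 d.2 ≠ lab s (vortex k) := fun d k => by
    rw [lab_eq]
    exact AffineFamily.cast_ne_of_sep (sep_family_vortex _ _ _) (inRange_family _ _)
      (inRange_vortex _) (adm hs _ _) (AffineFamily.const_adm hs')
  rintro (⟨t, i⟩ | k) (⟨t', i'⟩ | l) h
  · simp only [Sum.elim_inl] at h
    by_cases hti : (t.1, i) = (t'.1, i')
    · obtain ⟨t, j⟩ := t
      obtain ⟨t', j'⟩ := t'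
      simp only [Prod.mk.injEq] at hti
      obtain ⟨rfl, rfl⟩ := hti
      have hv := AffineFamily.val_eq_of_cast_eq (inRange_family _ _) (inRange_family _ _)
        (adm hs ⟨t, j⟩ i) (adm hs ⟨t, j'⟩ i) h
      -- A type below 25 has a single vertex; in a ladder the nonzero step determines the index.
      have hj : (j : ℕ) = j' := by
        by_cases ht : t < 25
        · have h1 := j.2
          have h2 := j'.2
          simp only [count, ht, if_true] at h1 h2
          omega
        · have := mul_left_cancel₀ (step_ne_zero t (not_lt.1 ht) i) (add_left_cancel hv)
          exact_mod_cast this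
      rw [Fin.ext hj]
    · exact absurd h (AffineFamily.cast_ne_of_sep (sep_family _ _ _ _ hti) (inRange_family _ _)
        (inRange_family _ _) (adm hs _ _) (adm hs _ _))
  · exact absurd h (hfv _ _)
  · exact absurd h.symm (hfv _ _)
  · by_cases hkl : k = l
    · rw [hkl]
    · simp only [Sum.elim_inr, lab_eq] at h
      exact absurd h (AffineFamily.cast_ne_of_sep (sep_vortex _ _ hkl) (inRange_vortex _)
        (inRange_vortex _) (AffineFamily.const_adm hs') (AffineFamily.const_adm hs'))

theorem current_ne_zero (hs : 7 ≤ s) (t : Cubic s) (i : Fin 3) : current s t i ≠ 0 := by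
  have h := AffineFamily.cast_ne_of_sep (sep_family_zero t.1 i) (inRange_family _ _)
    (by decide +kernel) (adm hs t i) (AffineFamily.const_adm (by exact_mod_cast hs))
  simpa [AffineFamily.const, AffineFamily.val, current] using h

theorem lab_vortex_ne_zero (hs : 7 ≤ s) (k : Fin 4) : lab s (vortex k) ≠ 0 := by
  have hs' : (7 : ℤ) ≤ s := by exact_mod_cast hs
  have h := AffineFamily.cast_ne_of_sep (sep_vortex_zero k) (inRange_vortex k)
    (by decide +kernel) (AffineFamily.const_adm hs') (AffineFamily.const_adm hs')
  rw [lab_eq]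
  simpa [AffineFamily.const, AffineFamily.val] using h

theorem current_sum (t : Cubic s) : current s t 0 + current s t 1 + current s t 2 = 0 := by
  obtain ⟨h1, k, h2, h3⟩ := sum_coeff t.1
  simp only [current, ← Int.cast_add]
  have : (family t.1 0).val s (t.2 : ℕ) + (family t.1 1).val s (t.2 : ℕ) +
      (family t.1 2).val s (t.2 : ℕ) = (12 * s + 2 : ℤ) * ((k : ℤ) - 1) := by
    simp only [AffineFamily.val, family]
    linear_combination h2 + (s : ℤ) * h3 + ((t.2 : ℕ) : ℤ) * h1
  rw [this, Int.cast_mul]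
  have h0 := cast_modulus s
  push_cast at h0 ⊢
  rw [h0, zero_mul]

/-- The current graph for `12 * s + 5`, where `s ≥ 7`. -/
def currentGraph (hs : 7 ≤ s) : CurrentGraph (ZMod (12 * s + 2)) (Cubic s) (Fin 4) where
  tri := current s
  cur k := lab s (vortex k)
  inj := current_injective hs
  tri_ne := current_ne_zero hs
  cur_ne := lab_vortex_ne_zero hs
  surj x hx := by
    classical
    have hinj := current_injective hs
    have hsub : Finset.univ.image (Sum.elim (fun d : Cubic s × Fin 3 => current s d.1 d.2)
        (fun k => lab s (vortex k))) ⊆ Finset.univ.erase 0 := by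
      intro y hy
      obtain ⟨d | k, -, rfl⟩ := Finset.mem_image.1 hy
      · exact Finset.mem_erase.2 ⟨current_ne_zero hs _ _, Finset.mem_univ _⟩
      · exact Finset.mem_erase.2 ⟨lab_vortex_ne_zero hs _, Finset.mem_univ _⟩
    -- Surjectivity by counting: `3 (4 s - 1) + 4 = 12 s + 1` distinct nonzero currents exhaust the
    -- nonzero residues.
    have heq := Finset.eq_of_subset_of_card_le hsub (by
      rw [Finset.card_image_of_injective _ hinj, Finset.card_erase_of_mem (Finset.mem_univ _),
        Finset.card_univ, Finset.card_univ, ZMod.card, Fintype.card_sum, Fintype.card_prod,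
        card_cubic hs, Fintype.card_fin, Fintype.card_fin]
      omega)
    have hx' : x ∈ Finset.univ.erase (0 : ZMod (12 * s + 2)) :=
      Finset.mem_erase.2 ⟨hx, Finset.mem_univ _⟩
    rw [← heq] at hx'
    obtain ⟨d | k, -, h⟩ := Finset.mem_image.1 hx'
    · exact Or.inl ⟨d.1, d.2, h⟩
    · exact Or.inr ⟨k, h⟩
  sum_eq := current_sum

end GenericPrism

/-! ### The rotation at the base point is a single orbit. -/

namespace GenericPrism

variable {s : ℕ}

/-- The two labels of the involution are identified. -/
def normLabel (p : ℤ × ℤ) : ℤ × ℤ := if p = (-1, -6) then (1, 6) else p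

/-- The rotation at the base point, with each strand of a ladder contracted to one step. -/
def labelSteps : List ((ℤ × ℤ) × (ℤ × ℤ)) :=
  ((List.finRange 25).flatMap fun t => (List.finRange 3).map fun i =>
    (normLabel (-(coeff (t.castLE (by decide)) i).1, -(coeff (t.castLE (by decide)) i).2.1),
      normLabel ((coeff (t.castLE (by decide)) (i + 1)).1,
        (coeff (t.castLE (by decide)) (i + 1)).2.1))) ++
  (List.finRange 4).map (fun k => (-vortex k, vortex k)) ++
  [((10, -3), (10, -6)), ((-7, -3), (-7, 0)), ((-10, 6), (7, 3)), ((7, 0), (-10, 3))]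

/-- The labels reached from `p` by at most `n` steps. -/
def labelOrbit : ℕ → ℤ × ℤ → List (ℤ × ℤ)
  | 0, p => [p]
  | n + 1, p => p :: match labelSteps.lookup p with
    | some q => labelOrbit n q
    | none => []

theorem labelOrbit_sound {α : Type*} (r : Setoid α) (f : ℤ × ℤ → α)
    (h : ∀ e ∈ labelSteps, r (f e.1) (f e.2)) (n : ℕ) (p q : ℤ × ℤ) (hq : q ∈ labelOrbit n p) :
    r (f p) (f q) := by
  induction n generalizing p with
  | zero => rw [List.mem_singleton.1 hq]
  | succ n ih =>
    rcases List.mem_cons.1 hq with rfl | hq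
    · rfl
    · split at hq
      · rename_i p' hp'
        have hmem : (p, p') ∈ labelSteps := by
          obtain ⟨l₁, l₂, h1, -⟩ := List.lookup_eq_some_iff.1 hp'
          rw [h1]; simp
        exact r.trans (h _ hmem) (ih p' hq)
      · cases hq

/-- Contracting the ladder strands leaves a rotation whose length does not depend on `s`. The bound
`83 = 3 * 25 + 4 + 4` is the number of entries of `labelSteps`. -/
theorem mem_labelOrbit_coeff : ∀ t : Fin 29, t < 25 → ∀ i,
    normLabel ((coeff t i).1, (coeff t i).2.1) ∈ labelOrbit 83 (1, 0) := by
  decide +kernel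

theorem mem_labelOrbit_vortex : ∀ k, vortex k ∈ labelOrbit 83 (1, 0) := by
  decide +kernel

theorem mem_labelOrbit_strands : ∀ p ∈ [((10, -3) : ℤ × ℤ), (-7, -3), (7, 3), (-10, 3)],
    p ∈ labelOrbit 83 (1, 0) := by
  decide +kernel

theorem lab_normLabel (p : ℤ × ℤ) : lab s (normLabel p) = lab s p := by
  unfold normLabel
  split_ifs with h
  · subst h
    have := cast_modulus s
    simp only [lab]
    push_cast at this ⊢
    linear_combination this
  · rfl

theorem lab_neg (p : ℤ × ℤ) : lab s (-p) = -lab s p := by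
  simp only [lab, Prod.fst_neg, Prod.snd_neg, ← Int.cast_neg]
  congr 1
  ring

/-- The four strands of the two ladders. -/
theorem strands {q : Setoid ℤ} {L : ℤ}
    (hA : ∀ j, 0 ≤ j → j < L → q (-3 * s + 10 + 3 * j) (-3 * s - 11 - 3 * j) ∧
      q (3 * s + 11 + 3 * j) (21 + 6 * j) ∧ q (-21 - 6 * j) (3 * s - 10 - 3 * j))
    (hC : ∀ j, 0 ≤ j → j < L → q (-3 * s - 7 - 3 * j) (-3 * s + 14 + 3 * j) ∧
      q (3 * s - 14 - 3 * j) (-21 - 6 * j) ∧ q (21 + 6 * j) (3 * s + 7 + 3 * j))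
    (hB : ∀ j, 0 ≤ j → j < L - 1 → q (-3 * s - 11 - 3 * j) (-3 * s + 13 + 3 * j) ∧
      q (3 * s - 13 - 3 * j) (-24 - 6 * j) ∧ q (24 + 6 * j) (3 * s + 11 + 3 * j))
    (hE : ∀ j, 0 ≤ j → j < L - 1 → q (-3 * s + 14 + 3 * j) (-3 * s - 10 - 3 * j) ∧
      q (3 * s + 10 + 3 * j) (24 + 6 * j) ∧ q (-24 - 6 * j) (3 * s - 14 - 3 * j)) (j : ℤ)
    (hj0 : 0 ≤ j) (hj : j < L) :
    q (-3 * s + 10) (-3 * s + 10 + 3 * j) ∧ q (-3 * s - 7) (-3 * s - 7 - 3 * j) ∧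
      q (3 * s + 7) (3 * s + 7 + 3 * j) ∧ q (3 * s - 10) (3 * s - 10 - 3 * j) := by
  lift j to ℕ using hj0
  induction j with
  | zero => simp
  | succ j ih =>
    have hj' : (j : ℤ) < L := by push_cast at hj; linarith
    have hj1 : (j : ℤ) < L - 1 := by push_cast at hj; linarith
    have hj0 : (0 : ℤ) ≤ j := by positivity
    obtain ⟨h1, h2, h3, h4⟩ := ih hj'
    obtain ⟨a1, a2, a3⟩ := hA j hj0 hj'
    obtain ⟨c1, c2, c3⟩ := hC j hj0 hj'
    obtain ⟨b1, b2, b3⟩ := hB j hj0 hj1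
    obtain ⟨e1, e2, e3⟩ := hE j hj0 hj1
    push_cast
    refine ⟨?_, ?_, ?_, ?_⟩
    · rw [show (-3 * s + 10 + 3 * ((j : ℤ) + 1) : ℤ) = -3 * s + 13 + 3 * j by ring]
      -- The strand alternates between rungs of two types, and two rotation steps advance it by one
      -- index. The last two strands are followed against the rotation.
      exact q.trans h1 (q.trans a1 b1)
    · rw [show (-3 * s - 7 - 3 * ((j : ℤ) + 1) : ℤ) = -3 * s - 10 - 3 * j by ring]
      exact q.trans h2 (q.trans c1 e1)
    · rw [show (3 * s + 7 + 3 * ((j : ℤ) + 1) : ℤ) = 3 * s + 10 + 3 * j by ring]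
      exact q.trans h3 (q.trans (q.symm c3) (q.trans (q.symm a2) (q.trans (q.symm b3) (q.symm e2))))
    · rw [show (3 * s - 10 - 3 * ((j : ℤ) + 1) : ℤ) = 3 * s - 13 - 3 * j by ring]
      exact q.trans h4 (q.trans (q.symm a3) (q.trans (q.symm c2) (q.trans (q.symm e3) (q.symm b2))))

/-- The contracted orbit joins 1 to every current outside the ladders and to the end of each strand
with index 0; `strands` then reaches the ladder currents. -/
theorem currentGraph_connected (hs : 7 ≤ s) : (currentGraph hs).Connected := by
  intro q htri hcur
  let q' : Setoid ℤ := q.comap fun x => (x : ZMod (12 * s + 2))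
  have hstep : ∀ (t : Fin 29) (j : ℤ), 0 ≤ j → j < count s t → ∀ i,
      q' (-(family t i).val s j) ((family t (i + 1)).val s j) := by
    intro t j hj0 hj i
    lift j to ℕ using hj0
    have := htri ⟨t, j, by exact_mod_cast hj⟩ i
    change q _ _
    push_cast
    exact this
  set L : ℤ := s - 6 with hL
  have c25 : (count s 25 : ℤ) = L := by
    have : count s 25 = s - 6 := rfl
    omega
  have c26 : (count s 26 : ℤ) = L := by
    have : count s 26 = s - 6 := rfl
    omega
  have c27 : (count s 27 : ℤ) = L - 1 := by
    have : count s 27 = s - 7 := rfl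
    omega
  have c28 : (count s 28 : ℤ) = L - 1 := by
    have : count s 28 = s - 7 := rfl
    omega
  have hA : ∀ j, 0 ≤ j → j < L → q' (-3 * s + 10 + 3 * j) (-3 * s - 11 - 3 * j) ∧
      q' (3 * s + 11 + 3 * j) (21 + 6 * j) ∧ q' (-21 - 6 * j) (3 * s - 10 - 3 * j) := by
    intro j h0 h1
    have h := hstep 25 j h0 (c25 ▸ h1)
    refine ⟨?_, ?_, ?_⟩
    · convert h 0 using 1 <;> simp [AffineFamily.val, family, coeff] <;> ring
    · convert h 1 using 1 <;> simp [AffineFamily.val, family, coeff] <;> ring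
    · convert h 2 using 1 <;> simp [AffineFamily.val, family, coeff] <;> ring
  have hC : ∀ j, 0 ≤ j → j < L → q' (-3 * s - 7 - 3 * j) (-3 * s + 14 + 3 * j) ∧
      q' (3 * s - 14 - 3 * j) (-21 - 6 * j) ∧ q' (21 + 6 * j) (3 * s + 7 + 3 * j) := by
    intro j h0 h1
    have h := hstep 26 j h0 (c26 ▸ h1)
    refine ⟨?_, ?_, ?_⟩
    · convert h 0 using 1 <;> simp [AffineFamily.val, family, coeff] <;> ring
    · convert h 1 using 1 <;> simp [AffineFamily.val, family, coeff] <;> ring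
    · convert h 2 using 1 <;> simp [AffineFamily.val, family, coeff] <;> ring
  have hB : ∀ j, 0 ≤ j → j < L - 1 → q' (-3 * s - 11 - 3 * j) (-3 * s + 13 + 3 * j) ∧
      q' (3 * s - 13 - 3 * j) (-24 - 6 * j) ∧ q' (24 + 6 * j) (3 * s + 11 + 3 * j) := by
    intro j h0 h1
    have h := hstep 27 j h0 (c27 ▸ h1)
    refine ⟨?_, ?_, ?_⟩
    · convert h 0 using 1 <;> simp [AffineFamily.val, family, coeff] <;> ring
    · convert h 1 using 1 <;> simp [AffineFamily.val, family, coeff] <;> ring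
    · convert h 2 using 1 <;> simp [AffineFamily.val, family, coeff] <;> ring
  have hE : ∀ j, 0 ≤ j → j < L - 1 → q' (-3 * s + 14 + 3 * j) (-3 * s - 10 - 3 * j) ∧
      q' (3 * s + 10 + 3 * j) (24 + 6 * j) ∧ q' (-24 - 6 * j) (3 * s - 14 - 3 * j) := by
    intro j h0 h1
    have h := hstep 28 j h0 (c28 ▸ h1)
    refine ⟨?_, ?_, ?_⟩
    · convert h 0 using 1 <;> simp [AffineFamily.val, family, coeff] <;> ring
    · convert h 1 using 1 <;> simp [AffineFamily.val, family, coeff] <;> ring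
    · convert h 2 using 1 <;> simp [AffineFamily.val, family, coeff] <;> ring
  have hS := strands hA hC hB hE
  have hlab : ∀ (p p' : ℤ × ℤ) (x y : ℤ), p.1 + p.2 * s = x → p'.1 + p'.2 * s = y → q' x y →
      q (lab s p) (lab s p') := by
    rintro p p' x y rfl rfl h
    exact h
  have hsteps : ∀ e ∈ labelSteps, q (lab s e.1) (lab s e.2) := by
    intro e he
    simp only [labelSteps, List.mem_append, List.mem_flatMap, List.mem_map, List.mem_cons,
      List.not_mem_nil, or_false] at he
    rcases he with (⟨t, -, i, -, rfl⟩ | ⟨k, -, rfl⟩) | he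
    · simp only [lab_normLabel]
      have := hstep (t.castLE (by decide)) 0 le_rfl (by
        have : (t.castLE (by decide) : Fin 29) < 25 := t.2
        simp [count, this]) i
      refine hlab _ _ _ _ ?_ ?_ this
      · simp [AffineFamily.val, family]
        ring
      · simp [AffineFamily.val, family]
    · simp only [lab_neg]
      exact hcur k
    · have h0 : (0 : ℤ) ≤ L - 1 := by omega
      obtain ⟨h1, h2, h3, h4⟩ := hS (L - 1) h0 (by omega)
      obtain ⟨a1, a2, a3⟩ := hA (L - 1) h0 (by omega)
      obtain ⟨c1, c2, c3⟩ := hC (L - 1) h0 (by omega)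
      -- Beyond the last index `L - 1 = s - 7` a strand leaves its ladder: for instance `-3 s - 11 -
      -- 3 (s - 7)` is the label `(10, -6)`.
      rcases he with rfl | rfl | rfl | rfl
      · exact hlab _ _ _ _ (by ring) (by rw [hL]; ring) (q'.trans h1 a1)
      · exact hlab _ _ _ _ (by ring) (by rw [hL]; ring) (q'.trans h2 c1)
      · exact hlab _ _ _ _ (by rw [hL]; ring) (by ring)
          (q'.trans a2 (q'.trans c3 (q'.symm h3)))
      · exact hlab _ _ _ _ (by rw [hL]; ring) (by ring)
          (q'.trans c2 (q'.trans a3 (q'.symm h4)))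
  have horb := labelOrbit_sound q (lab s) hsteps 83 (1, 0)
  have hhead : ∀ p ∈ [((10, -3) : ℤ × ℤ), (-7, -3), (7, 3), (-10, 3)], ∀ x : ℤ,
      p.1 + p.2 * s = x → q' 1 x := by
    rintro p hp x rfl
    have := horb p (mem_labelOrbit_strands p hp)
    change q ((1 : ℤ) : ZMod (12 * s + 2)) _
    simpa [lab] using this
  have r1 := hhead (10, -3) (by simp) (-3 * s + 10) (by ring)
  have r2 := hhead (-7, -3) (by simp) (-3 * s - 7) (by ring)
  have r3 := hhead (7, 3) (by simp) (3 * s + 7) (by ring)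
  have r4 := hhead (-10, 3) (by simp) (3 * s - 10) (by ring)
  have hroot : ∀ x : ZMod (12 * s + 2), x ≠ 0 → q (lab s (1, 0)) x := by
    intro x hx
    rcases (currentGraph hs).surj x hx with ⟨⟨t, j⟩, i, rfl⟩ | ⟨k, rfl⟩
    · by_cases ht : t < 25
      · have h := horb _ (mem_labelOrbit_coeff t ht i)
        rw [lab_normLabel] at h
        have hj : (j : ℕ) = 0 := by
          have := j.2
          simp only [count, ht, if_true] at this
          omega
        convert h using 1
        change current s ⟨t, j⟩ i = _
        simp [current, AffineFamily.val, hj, lab, family]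
      · suffices hval : q' 1 ((family t i).val s (j : ℕ)) by
          have h1 : lab s (1, 0) = ((1 : ℤ) : ZMod (12 * s + 2)) := by simp [lab]
          rw [h1]
          exact hval
        have hj0 : (0 : ℤ) ≤ (j : ℕ) := by positivity
        have hj1 : ((j : ℕ) : ℤ) < count s t := by exact_mod_cast j.2
        generalize ((j : ℕ) : ℤ) = j' at hj0 hj1
        have hjL : j' < L := by
          unfold count at hj1
          split_ifs at hj1 <;> omega
        obtain ⟨h1, h2, h3, h4⟩ := hS j' hj0 hjL
        obtain ⟨a1, a2, a3⟩ := hA j' hj0 hjL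
        obtain ⟨c1, c2, c3⟩ := hC j' hj0 hjL
        -- From the strand points of index `j'`, one or two further rotation steps, in either
        -- direction, give the remaining currents of the rungs.
        have w1 := q'.trans (q'.trans r1 h1) a1
        have w2 := q'.trans (q'.trans r2 h2) c1
        have w3 := q'.trans (q'.trans r3 h3) (q'.symm c3)
        have w4 := q'.trans (q'.trans r4 h4) (q'.symm a3)
        have w5 := q'.trans w3 (q'.symm a2)
        have w6 := q'.trans w4 (q'.symm c2)
        have ht' : t = 25 ∨ t = 26 ∨ t = 27 ∨ t = 28 :=
          (show ∀ t : Fin 29, ¬ t < 25 → t = 25 ∨ t = 26 ∨ t = 27 ∨ t = 28 by decide) t ht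
        rcases ht' with rfl | rfl | rfl | rfl
        · fin_cases i
          · convert q'.trans r4 h4 using 1; simp [AffineFamily.val, family, coeff]; try ring
          · convert w1 using 1; simp [AffineFamily.val, family, coeff]; try ring
          · convert w3 using 1; simp [AffineFamily.val, family, coeff]; try ring
        · fin_cases i
          · convert q'.trans r3 h3 using 1; simp [AffineFamily.val, family, coeff]; try ring
          · convert w2 using 1; simp [AffineFamily.val, family, coeff]; try ring
          · convert w4 using 1; simp [AffineFamily.val, family, coeff]; try ring
        · obtain ⟨b1, b2, b3⟩ := hB j' hj0 (c27 ▸ hj1)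
          obtain ⟨e1, e2, e3⟩ := hE j' hj0 (c27 ▸ hj1)
          fin_cases i
          · convert w5 using 1; simp [AffineFamily.val, family, coeff]; try ring
          · convert q'.trans w1 b1 using 1; simp [AffineFamily.val, family, coeff]; try ring
          · convert q'.trans w6 (q'.symm e3) using 1; simp [AffineFamily.val, family, coeff]; try ring
        · obtain ⟨b1, b2, b3⟩ := hB j' hj0 (c28 ▸ hj1)
          obtain ⟨e1, e2, e3⟩ := hE j' hj0 (c28 ▸ hj1)
          fin_cases i
          · convert w6 using 1; simp [AffineFamily.val, family, coeff]; try ring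
          · convert q'.trans w2 e1 using 1; simp [AffineFamily.val, family, coeff]; try ring
          · convert q'.trans w5 (q'.symm b3) using 1; simp [AffineFamily.val, family, coeff]; try ring
    · exact horb _ (mem_labelOrbit_vortex k)
  intro x y hx hy
  exact q.trans (q.symm (hroot x hx)) (hroot y hy)

end GenericPrism

/-! ### Operations given by lists of triples, and links of generating vortices. -/

/-- The partial operation given by a list of oriented triples. -/
def thirdOf {J : Type*} [DecidableEq J] (l : List (J × J × J)) (a b : J) : Option J :=
  l.findSome? fun t =>
    if t.1 = a ∧ t.2.1 = b then some t.2.2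
    else if t.2.1 = a ∧ t.2.2 = b then some t.1
    else if t.2.2 = a ∧ t.1 = b then some t.2.1
    else none

theorem exists_of_thirdOf {J : Type*} [DecidableEq J] {l : List (J × J × J)} {a b c : J}
    (h : thirdOf l a b = some c) :
    (a, b, c) ∈ l ∨ (c, a, b) ∈ l ∨ (b, c, a) ∈ l := by
  obtain ⟨⟨x, y, z⟩, ht, h'⟩ := List.exists_of_findSome?_eq_some h
  simp only at h'
  split_ifs at h' with h1 h2 h3
  · obtain ⟨rfl, rfl⟩ := h1
    obtain rfl := Option.some.inj h'
    exact Or.inl ht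
  · obtain ⟨rfl, rfl⟩ := h2
    obtain rfl := Option.some.inj h'
    exact Or.inr (Or.inl ht)
  · obtain ⟨rfl, rfl⟩ := h3
    obtain rfl := Option.some.inj h'
    exact Or.inr (Or.inr ht)

/-- The link of a vortex whose current generates a cyclic group. -/
theorem related_of_isUnit {m : ℕ} [NeZero m] {g : ZMod m} (hg : IsUnit g) (q : Setoid (ZMod m))
    (h : ∀ x, q x (x - g)) (x y : ZMod m) : q x y := by
  have key : ∀ (k : ℕ) (x : ZMod m), q x (x - k * g) := by
    intro k
    induction k with
    | zero => intro x; simp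
    | succ k ih =>
      intro x
      have := q.trans (ih x) (h _)
      rwa [show x - (k : ZMod m) * g - g = x - ((k + 1 : ℕ) : ZMod m) * g by push_cast; ring] at this
  obtain ⟨u, rfl⟩ := hg
  have := key ((x - y) * (u⁻¹ : (ZMod m)ˣ)).val x
  simpa using this

/-! ### The exchange that makes the four vortices mutually adjacent. -/

namespace GenericPrism

/-- Labels of the points involved in the exchange, other than the vortices. -/
def position : Fin 14 → ℤ × ℤ := ![(5, -6), (6, -6), (9, -6), (-7, 0), (-1, 0), (0, 0), (1, 0),
  (2, 0), (5, 0), (8, 0), (-10, 6), (-2, 6), (-1, 6), (0, 6)]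

/-- The removed triples with a vortex. -/
def oldVortexTriples : List (Fin 4 × Fin 14 × Fin 14) := [
  (0, 5, 6), (1, 12, 5), (2, 9, 4), (3, 7, 9), (2, 1, 12), (2, 12, 10), (0, 11, 12), (0, 12, 13),
  (3, 3, 4), (3, 4, 8), (1, 0, 9), (1, 9, 2)]

/-- The removed triples without a vortex. -/
def oldInnerTriples : List (Fin 14 × Fin 14 × Fin 14) := [
  (6, 5, 12), (4, 9, 7), (1, 10, 4), (10, 1, 9), (11, 13, 9), (13, 11, 7), (3, 8, 6),
  (8, 3, 5), (0, 2, 5), (2, 0, 12)]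

/-- The triples removed by the exchange; the indices `14, …, 17` stand for the vortices. -/
def oldTriples : List (Fin 18 × Fin 18 × Fin 18) :=
  oldVortexTriples.map (fun t => (t.1.natAdd 14, t.2.1.castAdd 4, t.2.2.castAdd 4)) ++
  oldInnerTriples.map (fun t => (t.1.castAdd 4, t.2.1.castAdd 4, t.2.2.castAdd 4))

/-- The triples inserted by the exchange. -/
def newTriples : List (Fin 18 × Fin 18 × Fin 18) := [
  (14, 5, 15), (14, 15, 17), (15, 12, 16), (12, 14, 16), (14, 12, 6), (17, 16, 14), (16, 9, 15),
  (9, 17, 15), (17, 7, 4), (17, 4, 16), (16, 1, 10), (1, 12, 10), (10, 4, 9), (1, 9, 4),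
  (14, 11, 13), (11, 12, 13), (13, 9, 7), (11, 7, 9), (17, 3, 8), (3, 4, 8), (8, 6, 5), (3, 5, 6),
  (15, 0, 2), (0, 9, 2), (2, 5, 12), (0, 12, 5)]

theorem new_rotate : ∀ a b, ∀ c ∈ thirdOf newTriples a b, thirdOf newTriples b c = some a := by
  decide +kernel

theorem old_rotate : ∀ a b, ∀ c ∈ thirdOf oldTriples a b, thirdOf oldTriples b c = some a := by
  decide +kernel

theorem new_self : ∀ a, thirdOf newTriples a a = none := by
  decide +kernel

theorem new_of_old : ∀ a b, (thirdOf oldTriples a b).isSome → (thirdOf newTriples a b).isSome := by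
  decide +kernel

theorem old_of_new : ∀ a b, (thirdOf newTriples a b).isSome →
    (thirdOf oldTriples a b).isSome ∨ 14 ≤ a ∧ 14 ≤ b := by
  decide +kernel

theorem new_of_vortices : ∀ k l : Fin 4, k ≠ l →
    (thirdOf newTriples (k.natAdd 14) (l.natAdd 14)).isSome := by
  decide +kernel

/-- The exchange is at fixed labels, so this check on 18 indices serves every `s`. Index 17 is the
vortex with current 6, whose link may be disconnected. -/
theorem old_link : ∀ k, k ≠ 17 → ∀ b, ∀ c ∈ thirdOf oldTriples b k,
    (Exchange.reach (thirdOf newTriples) k 6 (Exchange.retract (thirdOf oldTriples) k 6 b)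
        (Exchange.retract (thirdOf oldTriples) k 6 c) ||
      Exchange.reach (thirdOf newTriples) k 6 (Exchange.retract (thirdOf oldTriples) k 6 c)
        (Exchange.retract (thirdOf oldTriples) k 6 b)) = true := by
  decide +kernel

theorem new_link : ∀ k, k ≠ 17 → ∀ b, b ≠ k → ∃ b', b' ≠ k ∧ ¬ (14 ≤ b' ∧ 14 ≤ k) ∧
    Exchange.retract (thirdOf oldTriples) k 6 b' = b' ∧
    (Exchange.reach (thirdOf newTriples) k 6 b b' ||
      Exchange.reach (thirdOf newTriples) k 6 b' b) = true := by
  decide +kernel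

theorem sep_position : ∀ a b, a ≠ b →
    (AffineFamily.const (position a)).sep (.const (position b)) = true := by
  decide +kernel

theorem inRange_position : ∀ a, (AffineFamily.const (position a)).inRange = true := by
  decide +kernel

/-- The labels `p` and `q` are equal modulo `12 s + 2`. -/
def CongrLabel (p q : ℤ × ℤ) : Prop := ∃ k : Fin 3, p - q = (2 * ((k : ℤ) - 1), 12 * ((k : ℤ) - 1))

instance (p q : ℤ × ℤ) : Decidable (CongrLabel p q) := inferInstanceAs (Decidable (∃ _, _))

theorem derived_of_mem_vortex : oldVortexTriples.all (fun t => decide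
    (CongrLabel (position t.2.2) (position t.2.1 + vortex t.1))) = true := by
  decide +kernel

/-- Two consecutive differences are consecutive currents at a cubic vertex `r` outside the ladders,
so the triple belongs to the derived system for every `s ≥ 7`. -/
theorem derived_of_mem_inner : oldInnerTriples.all (fun t => decide
    (∃ (r : Fin 25) (i : Fin 3),
      CongrLabel (position t.2.1 - position t.1)
        ((coeff (r.castLE (by decide)) i).1, (coeff (r.castLE (by decide)) i).2.1) ∧
      CongrLabel (position t.2.2 - position t.2.1)
        ((coeff (r.castLE (by decide)) (i + 1)).1,
          (coeff (r.castLE (by decide)) (i + 1)).2.1))) = true := by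
  decide +kernel

theorem ne_of_mem : oldTriples.all (fun t => decide
    (t.1 ≠ t.2.1 ∧ ¬ (14 ≤ t.1 ∧ 14 ≤ t.2.1))) = true := by
  decide +kernel

theorem CongrLabel.lab_eq {s : ℕ} {p q : ℤ × ℤ} (h : CongrLabel p q) : lab s p = lab s q := by
  obtain ⟨k, hk⟩ := h
  have h1 := congrArg Prod.fst hk
  have h2 := congrArg Prod.snd hk
  simp only [Prod.fst_sub, Prod.snd_sub] at h1 h2
  rw [← sub_eq_zero, lab, lab, ← Int.cast_sub,
    show p.1 + p.2 * s - (q.1 + q.2 * s) = (12 * s + 2 : ℤ) * ((k : ℤ) - 1) by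
      linear_combination h1 + (s : ℤ) * h2, Int.cast_mul]
  have h0 := cast_modulus s
  push_cast at h0 ⊢
  rw [h0, zero_mul]

variable {s : ℕ}

/-- The points involved in the exchange. -/
def point (s : ℕ) (a : Fin 18) : ZMod (12 * s + 2) ⊕ Fin 4 :=
  Fin.addCases (m := 14) (n := 4) (fun v => Sum.inl (lab s (position v))) Sum.inr a

theorem point_castAdd (v : Fin 14) : point s (v.castAdd 4) = Sum.inl (lab s (position v)) :=
  Fin.addCases_left _

theorem point_natAdd (k : Fin 4) : point s (k.natAdd 14) = Sum.inr k :=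
  Fin.addCases_right _

theorem isRight_point (a : Fin 18) : (point s a).isRight = true ↔ 14 ≤ a := by
  refine Fin.addCases (m := 14) (n := 4) (fun v => ?_) (fun k => ?_) a
  · rw [point_castAdd]
    have := v.2
    simp [Fin.le_def]
  · rw [point_natAdd]
    simp [Fin.le_def]

theorem point_injective (hs : 7 ≤ s) : Function.Injective (point s) := by
  have hs' : (7 : ℤ) ≤ s := by exact_mod_cast hs
  intro a b
  refine Fin.addCases (m := 14) (n := 4) (fun v => ?_) (fun k => ?_) a <;>
    refine Fin.addCases (m := 14) (n := 4) (fun w => ?_) (fun l => ?_) b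
  · rw [point_castAdd, point_castAdd]
    intro h
    by_contra hne
    have hvw : v ≠ w := fun h => hne (by rw [h])
    have := Sum.inl.inj h
    rw [lab_eq, lab_eq] at this
    exact AffineFamily.cast_ne_of_sep (sep_position v w hvw) (inRange_position v)
      (inRange_position w) (AffineFamily.const_adm hs') (AffineFamily.const_adm hs') this
  · rw [point_castAdd, point_natAdd]
    exact fun h => by cases h
  · rw [point_castAdd, point_natAdd]
    exact fun h => by cases h
  · rw [point_natAdd, point_natAdd]
    exact fun h => by rw [Sum.inr.inj h]

theorem lab_add (p q : ℤ × ℤ) : lab s (p + q) = lab s p + lab s q := by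
  simp only [lab, Prod.fst_add, Prod.snd_add]
  push_cast
  ring

theorem lab_sub (p q : ℤ × ℤ) : lab s (p - q) = lab s p - lab s q := by
  simp only [lab, Prod.fst_sub, Prod.snd_sub]
  push_cast
  ring

theorem third_point_of_mem (hs : 7 ≤ s) {a b c : Fin 18} (h : (a, b, c) ∈ oldTriples) :
    (currentGraph hs).third (point s a) (point s b) = point s c := by
  rcases List.mem_append.1 h with h | h <;> obtain ⟨⟨u, v, w⟩, hm, ht⟩ := List.mem_map.1 h <;>
    simp only [Prod.mk.injEq] at ht <;> obtain ⟨rfl, rfl, rfl⟩ := ht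
  · have hc := of_decide_eq_true (List.all_eq_true.1 derived_of_mem_vortex _ hm)
    rw [point_natAdd, point_castAdd, point_castAdd, hc.lab_eq, lab_add]
    rfl
  · obtain ⟨r, i, h1, h2⟩ := of_decide_eq_true (List.all_eq_true.1 derived_of_mem_inner _ hm)
    have hr : (r.castLE (by decide) : Fin 29) < 25 := r.2
    have hcur : ∀ i, lab s ((coeff (r.castLE (by decide)) i).1, (coeff (r.castLE (by decide)) i).2.1)
        = (currentGraph hs).tri ⟨r.castLE (by decide), ⟨0, by simp [count, hr]⟩⟩ i := fun i => by
      change _ = current s _ i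
      simp [current, lab, AffineFamily.val, family]
    have h1' := h1.lab_eq (s := s)
    have h2' := h2.lab_eq (s := s)
    rw [lab_sub, hcur] at h1' h2'
    rw [point_castAdd, point_castAdd, point_castAdd, CurrentGraph.third_of_tri _ h1', ← h2']
    congr 1
    abel

/-- The exchange that joins the vortices. -/
noncomputable def vortexExchange (hs : 7 ≤ s) :
    Exchange (fun x : ZMod (12 * s + 2) ⊕ Fin 4 => x.isRight = true) (currentGraph hs).third
      (Fin 18) where
  pt := point s
  inj := point_injective hs
  old := thirdOf oldTriples
  new := thirdOf newTriples
  new_rotate := new_rotate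
  new_ne a b c h := by
    rintro rfl
    rw [new_self] at h
    cases h
  old_rotate := old_rotate
  old_eq a b c h := by
    have hP := (currentGraph hs).isPartialTripleSystem
    have key : ∀ x y z, (x, y, z) ∈ oldTriples → point s x ≠ point s y ∧
        ¬ ((point s x).isRight = true ∧ (point s y).isRight = true) ∧
        (currentGraph hs).third (point s x) (point s y) = point s z ∧
        (currentGraph hs).third (point s y) (point s z) = point s x := by
      intro x y z hm
      have h1 := third_point_of_mem hs hm
      obtain ⟨h2, h3⟩ := of_decide_eq_true (List.all_eq_true.1 ne_of_mem _ hm)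
      have h2' := (point_injective hs).ne h2
      simp only [← isRight_point (s := s)] at h3
      refine ⟨h2', h3, h1, ?_⟩
      rw [← h1]
      exact hP.rotate _ _ h2' h3
    -- Each triple is listed in one of its three cyclic orders only; the other two follow by
    -- rotation in the derived system.
    rcases exists_of_thirdOf h with hm | hm | hm
    · exact (key _ _ _ hm).2.2.1
    · exact (key _ _ _ hm).2.2.2
    · obtain ⟨h1, h2, h3, h4⟩ := key _ _ _ hm
      have h5 := hP.ne_right _ _ h1 h2
      have h6 := hP.not_of_right _ _ h1 h2
      rw [h3] at h5 h6
      have h7 := hP.rotate _ _ h5.symm fun h => h6 h.1 h.2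
      rwa [h4] at h7
  new_of_old := new_of_old
  old_of_new a b h := by
    simpa only [isRight_point] using old_of_new a b h
  new_of_letters := by
    rintro (x | k) (y | l) hkl hx hy
    · cases hx
    · cases hx
    · cases hy
    · exact ⟨k.natAdd 14, l.natAdd 14, point_natAdd k, point_natAdd l,
        new_of_vortices k l fun h => hkl (by rw [h])⟩

/-- Bézout identities hold uniformly in `s` for 1, `1 - 6 s` and -9. The excluded current 6 shares
the factor 2 with the modulus. -/
theorem isUnit_lab_vortex (k : Fin 4) (hk : k ≠ 3) : IsUnit (lab s (vortex k)) := by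
  have hunit : ∀ z : ℤ, IsCoprime z (12 * s + 2) → IsUnit (z : ZMod (12 * s + 2)) := by
    rintro z ⟨a, b, hab⟩
    refine IsUnit.of_mul_eq_one (a : ZMod (12 * s + 2)) ?_
    have h := congrArg (fun x : ℤ => (x : ZMod (12 * s + 2))) hab
    have h0 := cast_modulus s
    simp only [Int.cast_add, Int.cast_mul b, h0, mul_zero, add_zero, Int.cast_one] at h
    rw [← h]
    push_cast
    ring
  apply hunit
  have hk' : k = 0 ∨ k = 1 ∨ k = 2 := by revert k; decide
  rcases hk' with rfl | rfl | rfl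
  · exact ⟨1, 0, by simp [vortex]⟩
  · have h1 : IsCoprime (1 - 6 * s : ℤ) (6 * s + 1) := ⟨3 * s + 1, 3 * s, by ring⟩
    have h2 : IsCoprime (1 - 6 * s : ℤ) 2 := ⟨1, 3 * s, by ring⟩
    have h3 := h2.mul_right h1
    convert h3 using 1
    · simp [vortex]; ring
    · ring
  · have h1 : IsCoprime (3 : ℤ) (12 * s + 2) := ⟨4 * s + 1, -1, by ring⟩
    have h2 : IsCoprime ((3 : ℤ) * 3) (12 * s + 2) := h1.mul_left h1
    simpa [vortex] using h2.neg_left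

/-- The exceptional point is the vortex with current 6. The exchanged system covers all pairs, and
the connectedness of the other links is inherited from the derived system through the exchange. -/
theorem existsTripleSystem (hs : 7 ≤ s) : ExistsTripleSystem (12 * s + 5) := by
  have hP := (currentGraph hs).isPartialTripleSystem
  refine ⟨ZMod (12 * s + 2) ⊕ Fin 4, Sum.inr 3, (vortexExchange hs).op, inferInstance, ?_,
    (vortexExchange hs).isTripleSystem_op hP, fun v hv => ?_⟩
  · rw [Nat.card_sum, Nat.card_zmod, Nat.card_eq_fintype_card, Fintype.card_fin]
  · by_cases hpt : ∃ k, point s k = v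
    · obtain ⟨k, rfl⟩ := hpt
      have hk : k ≠ 17 := by
        rintro rfl
        exact hv (point_natAdd 3)
      refine (vortexExchange hs).linkConnected_pt hP (k := k) 6 ?_ (old_link k hk) ?_
      · intro r hr x y hx hy hxP hyP
        change ∀ a, a ≠ point s k → ¬ (a.isRight = true ∧ (point s k).isRight = true) →
          r a ((currentGraph hs).third a (point s k)) at hr
        change x ≠ point s k at hx
        change y ≠ point s k at hy
        change ¬ (x.isRight = true ∧ (point s k).isRight = true) at hxP
        change ¬ (y.isRight = true ∧ (point s k).isRight = true) at hyP
        generalize point s k = v at *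
        rcases v with v | l
        · refine (currentGraph_connected hs).link v r (fun a ha => hr a ha (by simp)) x y hx hy
        · rcases x with x | i
          · rcases y with y | j
            · have hl : l ≠ 3 := fun h => hv (by rw [h])
              -- In the derived system the link of vortex `l` is translation by minus its current.
              refine related_of_isUnit (isUnit_lab_vortex (s := s) l hl) (r.comap Sum.inl)
                (fun z => ?_) x y
              exact hr (Sum.inl z) (by simp) (by simp)
            · exact absurd ⟨rfl, rfl⟩ hyP
          · exact absurd ⟨rfl, rfl⟩ hxP
      · intro b hb
        obtain ⟨b', h1, h2, h3⟩ := new_link k hk b hb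
        refine ⟨b', h1, ?_, h3⟩
        change ¬ ((point s b').isRight = true ∧ (point s k).isRight = true)
        rwa [isRight_point, isRight_point]
    · have h : ∀ a, (vortexExchange hs).pt a ≠ v := fun a ha => hpt ⟨a, ha⟩
      refine (vortexExchange hs).linkConnected_of_forall_ne h ?_
      rcases v with v | l
      · exact (currentGraph_connected hs).link v
      -- All vortices take part in the exchange.
      · exact absurd ⟨_, point_natAdd l⟩ hpt

end GenericPrism

/-! ### All `s ≥ 1`, and the genus of the prism. -/

theorem existsTripleSystem_twelve_mul_add_five {s : ℕ} (hs : 1 ≤ s) : ExistsTripleSystem (12 * s + 5) := by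
  by_cases h : 7 ≤ s
  · exact GenericPrism.existsTripleSystem h
  · interval_cases s
    · exact existsTripleSystem_17
    · exact existsTripleSystem_29
    · exact existsTripleSystem_41
    · exact existsTripleSystem_53
    · exact existsTripleSystem_65
    · exact existsTripleSystem_77

theorem mainTheorem3 (s n : ℕ) (hs : 1 ≤ s) (hn : n = 12 * s + 5) :
    ∃ g : ℕ, (g : ℚ) = ((n : ℚ) - 2) * ((n : ℚ) - 3) / 6 ∧
      (∃ R : SimpleGraph.RotationSystem (SimpleGraph.prismGraph n),
        R.IsSnug ∧ R.HasGenus g) ∧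
      (SimpleGraph.prismGraph n).IsMinGenus g := by
  have hn2 : 2 ≤ n := by omega
  -- Integrality: `n - 2 = 3 (4 s + 1)` and `n - 3 = 2 (6 s + 1)`.
  have hg : ((n : ℤ) - 2) * (n - 3) = 6 * ((4 * s + 1) * (6 * s + 1) : ℕ) := by
    subst hn
    push_cast
    ring
  obtain ⟨R, hR⟩ := exists_isSnug hn2 (hn ▸ existsTripleSystem_twelve_mul_add_five hs)
  refine ⟨(4 * s + 1) * (6 * s + 1), ?_, ⟨R, hR, hR.hasGenus R hn2 hg⟩,
    SimpleGraph.isMinGenus_of_isSnug hn2 hg hR⟩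
  subst hn
  push_cast
  ring
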